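/- **Setting.** Let $\Omega=(a,b)\subset\mathbb R$, $a<b$, and $\gamma>1$. For $\varepsilon>0$ consider the scaled full Euler system $$\rho_t+\nabla\cdot(\rho u)=0,\quad (\rho u)_t+\nabla\cdot(\rho u\otimes u)+\tfrac1{\varepsilon^2}\nabla p=0,\quad E_t+\nabla\cdot[(E+p)u]=0,\quad E=\tfrac{p}{\gamma-1}+\tfrac{\varepsilon^2}{2}\rho|u|^2,$$ written as $U'=\mathcal H(U,U)$, $U=(\rho,q,E)$, $q=\rho u$, with $\mathcal H(U_E,U_I)=-\nabla\cdot\mathcal F_E-\nabla\cdot\mathcal F_{SI}$, $$\mathcal F_E=\Big(q_E,\ \tfrac{q_E\otimes q_E}{\rho_E}+\alpha p_E,\ 0\Big),\qquad \mathcal F_{SI}=\Big(0,\ \tfrac{1-\alpha\varepsilon^2}{\varepsilon^2}p_I,\ \tfrac{E_E+p_E}{\rho_I}q_I\Big),$$ where $\alpha=1$ for $\varepsilon<1$, $\alpha=\varepsilon^{-2}$ for $\varepsilon\ge1$, and $p_E,p_I$ are given by $E_E=\frac{p_E}{\gamma-1}+\varepsilon^2\frac{|q_E|^2}{2\rho_E}$,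 $E_I=\frac{p_I}{\gamma-1}+\varepsilon^2\frac{|q_E|^2}{2\rho_E}$. **Scheme.** An $s$-stage SI-IMEX Runge–Kutta scheme has a strictly lower triangular matrix $(\tilde a_{ij})$, a lower triangular invertible matrix $A=(a_{ij})$ and common weights $b_i$. One step of size $\Delta t$ from $U^0$ is $$U_E^{(i)}=U^0+\Delta t\sum_{j<i}\tilde a_{ij}\mathcal H(U_E^{(j)},U_I^{(j)}),\quad U_I^{(i)}=U^0+\Delta t\sum_{j\le i}a_{ij}\mathcal H(U_E^{(j)},U_I^{(j)}),\quad U^1=U^0+\Delta t\sum_i b_i\mathcal H(U_E^{(i)},U_I^{(i)}).$$ Its implicit part is stiffly accurate if $b_j=a_{sj}$ for all $j$ and $\sum_j a_{sj}=1$. It has order $r$ if, for every smooth $\mathcal H:\mathbb R^n\times\mathbb R^n\to\mathbb R^n$, its error after one step of size $h$ for $U'=\mathcal H(U,U)$ is $O(h^{r+1})$. For the Euler system the scheme is discrete in time and continuous in space; a numerical solution has stages that are smooth on $[a,b]$ with positive densities, and the zero Neumann condition $\partial_xp_I^{(i)}=0$ holds at $a$ and $b$. **Data.** The initial data $(\rho^0,\rho^0u^0,p^0)$,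 which may depend on $\varepsilon$, are smooth on $[a,b]$ and well-prepared: as $\varepsilon\to0^+$, $$\rho^0=\rho_0+O(\varepsilon^2),\qquad u^0=u_0+O(\varepsilon),\qquad p^0=p_*+\varepsilon^2p_2+o(\varepsilon^2),$$ uniformly on $[a,b]$ together with all $x$-derivatives, where $p_*>0$ is a constant, $\rho_0>0$, $\nabla\cdot u_0=0$, and $\rho_0,u_0,p_2$ are smooth on $[a,b]$ and independent of $\varepsilon$. **Proposition.** Take an SI-IMEX Runge–Kutta scheme of order $r$ whose implicit part is stiffly accurate (with $A$ invertible), and well-prepared data. Let $\rho^1(x;\varepsilon)$, $q^1(x;\varepsilon)=\rho^1u^1$, $p^1(x;\varepsilon)$ (with $p^1$ from the equation of state) be a numerical solution after one step of size $\Delta t$ for each small $\varepsilon>0$. 1. For every $\Delta t>0$: if the stage densities $\rho_E^{(i)},\rho_I^{(i)}$ are bounded below by a positive constant uniformly in $x$ and in small $\varepsilon$, then, uniformly on $[a,b]$, $$\lim_{\varepsilon\to0}p^1(x;\varepsilon)=p_*,\qquad\lim_{\varepsilon\to0}\nabla\cdot u^1(x;\varepsilon)=0.$$ 2. Let $(\rho_{inc},u_{inc},p_{inc})$,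 with hydrodynamic pressure $p_{2,inc}$ and $\rho_{inc}>0$, be a smooth solution on $[0,T]\times[a,b]$, $T>0$, of the incompressible Euler system $$p=\mathrm{const},\quad\nabla\cdot u=0,\quad\rho_t+\nabla\cdot(\rho u)=0,\quad(\rho u)_t+\nabla\cdot(\rho u\otimes u)+\nabla p_2=0,$$ with $\partial_xp_{2,inc}=0$ at $a$ and $b$ and initial data $(\rho_0,u_0,p_*)$. Then there are $C>0$ and $\Delta t_0\in(0,T]$, not depending on the numerical solution, such that for all $0<\Delta t\le\Delta t_0$ the limits in 1 hold without the assumption on the stage densities made there, $(\rho^1,q^1,p^1)(\cdot;\varepsilon)$ converges uniformly on $[a,b]$ as $\varepsilon\to0$, and $$\Big|\lim_{\varepsilon\to0}(\rho^1,\rho^1u^1,p^1)(x;\varepsilon)-(\rho_{inc},\rho_{inc}u_{inc},p_{inc})(x,\Delta t)\Big|\le C\,\Delta t^{\,r+1}$$ in every component and for every $x\in[a,b]$; that is, the scheme is asymptotically accurate. -/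

import Mathlib

open Set Filter Topology Asymptotics
open scoped ContDiff

noncomputable section

namespace SIIMEX

/-! ### Semi-implicit IMEX Runge–Kutta schemes -/

/-- A double Butcher tableau with `s` stages: an explicit matrix `aE` (strictly lower triangular), a
diagonally implicit matrix `aI` (lower triangular), and one common vector of weights `b`. -/
structure Tableau (s : ℕ) where
  aE : Matrix (Fin s) (Fin s) ℝ
  aI : Matrix (Fin s) (Fin s) ℝ
  b : Fin s → ℝ
  aE_explicit : ∀ i j, i ≤ j → aE i j = 0
  aI_diagonallyImplicit : ∀ i j, i < j → aI i j = 0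

variable {s : ℕ}

/-- The abscissae `c_i = ∑_j a_ij` of the implicit part. -/
def Tableau.cI (tab : Tableau s) (i : Fin s) : ℝ := ∑ j, tab.aI i j

/-- The implicit part is stiffly accurate: `bᵀ = e_sᵀ A` and `c_s = 1`, where `s` is the last stage. -/
def Tableau.IsStifflyAccurate (tab : Tableau s) : Prop :=
  ∃ l : Fin s, (∀ i, i ≤ l) ∧ (∀ j, tab.b j = tab.aI l j) ∧ tab.cI l = 1

/-- The stage equations `U_E⁽ⁱ⁾ = U⁰ + h ∑_j ã_ij K_j`, `U_I⁽ⁱ⁾ = U⁰ + h ∑_j a_ij K_j`. In the scheme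
for `U' = H(U, U)` one has `K_j = H(U_E⁽ʲ⁾, U_I⁽ʲ⁾)`. -/
def Tableau.StageEquations {V : Type*} [AddCommGroup V] [Module ℝ V] (tab : Tableau s) (h : ℝ)
    (U0 : V) (UE UI K : Fin s → V) : Prop :=
  ∀ i, UE i = U0 + h • ∑ j, tab.aE i j • K j ∧ UI i = U0 + h • ∑ j, tab.aI i j • K j

/-- The numerical solution `U¹ = U⁰ + h ∑_i b_i K_i` after one step. -/
def Tableau.update {V : Type*} [AddCommGroup V] [Module ℝ V] (tab : Tableau s) (h : ℝ)
    (U0 : V) (K : Fin s → V) : V :=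
  U0 + h • ∑ i, tab.b i • K i

/-- The SI-IMEX scheme has order (at least) `r`: for every smooth `H : ℝⁿ × ℝⁿ → ℝⁿ` and every
solution `U` of `U' = H(U, U)`, the error after one step of size `h` is `O(h^(r+1))` as `h → 0⁺`.
Since the stage equations are implicit, the stages meant are those that tend to `U(0)` with `h`. -/
def Tableau.HasOrder (tab : Tableau s) (r : ℕ) : Prop :=
  ∀ (n : ℕ) (H : (Fin n → ℝ) → (Fin n → ℝ) → (Fin n → ℝ)),
    ContDiff ℝ ∞ (fun z : (Fin n → ℝ) × (Fin n → ℝ) => H z.1 z.2) →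
    ∀ (T : ℝ) (U : ℝ → (Fin n → ℝ)), 0 < T →
      (∀ t ∈ Icc 0 T, HasDerivWithinAt U (H (U t) (U t)) (Icc 0 T) t) →
      ∀ UE UI : ℝ → Fin s → (Fin n → ℝ),
        (∀ᶠ h in 𝓝[>] (0 : ℝ),
          tab.StageEquations h (U 0) (UE h) (UI h) (fun j => H (UE h j) (UI h j))) →
        (∀ i, Tendsto (fun h => UE h i) (𝓝[>] 0) (𝓝 (U 0))) →
        (∀ i, Tendsto (fun h => UI h i) (𝓝[>] 0) (𝓝 (U 0))) →
        (fun h => tab.update h (U 0) (fun j => H (UE h j) (UI h j)) - U h)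
          =O[𝓝[>] 0] (fun h => h ^ (r + 1))

/-! ### The scaled full Euler system on a bounded interval -/

/-- Density, momentum and total energy as functions of `x`. -/
structure Fields where
  ρ : ℝ → ℝ
  q : ℝ → ℝ
  E : ℝ → ℝ

namespace Fields

/-- The value `(ρ(x), q(x), E(x))`. -/
def val (W : Fields) (x : ℝ) : ℝ × ℝ × ℝ := (W.ρ x, W.q x, W.E x)

/-- The velocity `u = q / ρ`. -/
def u (W : Fields) (x : ℝ) : ℝ := W.q x / W.ρ x

/-- The fields are smooth up to the boundary of the interval `(a, b)`. -/
def Smooth (a b : ℝ) (W : Fields) : Prop :=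
  ContDiffOn ℝ ∞ W.ρ (Icc a b) ∧ ContDiffOn ℝ ∞ W.q (Icc a b) ∧ ContDiffOn ℝ ∞ W.E (Icc a b)

end Fields

/-- The fields with density `ρ`, velocity `u` and pressure `p`; the energy is given by the equation of
state `E = p / (γ - 1) + ε² ρ u² / 2`. -/
def fieldsOf (γ ε : ℝ) (ρ u p : ℝ → ℝ) : Fields where
  ρ := ρ
  q := fun x => ρ x * u x
  E := fun x => p x / (γ - 1) + ε ^ 2 / 2 * (ρ x * u x ^ 2)

/-- The pressure of `Z` when the kinetic energy is taken from `W`, that is, the solution `p` of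
`E_Z = p / (γ - 1) + ε² q_W² / (2 ρ_W)`. With `W = Z` it is the equation of state of a polytropic gas. -/
def pressure (γ ε : ℝ) (W Z : Fields) (x : ℝ) : ℝ :=
  (γ - 1) * (Z.E x - ε ^ 2 * (W.q x ^ 2 / (2 * W.ρ x)))

/-- The parameter of the pressure splitting: `1` for `ε < 1`, and `1 / ε²` for `ε ≥ 1`. -/
def splitting (ε : ℝ) : ℝ := if ε < 1 then 1 else 1 / ε ^ 2

/-- The spatial derivative on the closed interval `[a, b]` (one-sided at the end points). In one space
dimension it is both the gradient and the divergence. -/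
def dx (a b : ℝ) (f : ℝ → ℝ) (x : ℝ) : ℝ := derivWithin f (Icc a b) x

/-- The partitioned right-hand side `H(U_E, U_I) = -∇·F_E - ∇·F_SI` of the scaled full Euler system, with
`F_E = (q_E, q_E²/ρ_E + α p_E, 0)` and `F_SI = (0, (1 - α ε²)/ε² p_I, (E_E + p_E)/ρ_I q_I)`. The pressures
`p_E` and `p_I` come from `E_E` and `E_I`, both with the explicit kinetic energy. -/
def eulerRHS (a b γ ε : ℝ) (UE UI : Fields) (x : ℝ) : ℝ × ℝ × ℝ :=
  ( -dx a b UE.q x,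
    -dx a b (fun y => UE.q y * UE.q y / UE.ρ y + splitting ε * pressure γ ε UE UE y) x
      - dx a b (fun y => (1 - splitting ε * ε ^ 2) / ε ^ 2 * pressure γ ε UE UI y) x,
    -dx a b (fun y => (UE.E y + pressure γ ε UE UE y) / UI.ρ y * UI.q y) x )

/-- `U1` is the numerical solution after one time step of size `Δt` of the SI-IMEX scheme (discrete in time,
continuous in space) for the scaled full Euler system on `(a, b)`, started from `U0`, with stages `UE`, `UI`.
The implicit pressure obeys the zero Neumann condition at the end points. -/
structure IsEulerStep (tab : Tableau s) (a b γ ε Δt : ℝ) (U0 : Fields) (UE UI : Fin s → Fields)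
    (U1 : Fields) : Prop where
  smooth_E : ∀ i, (UE i).Smooth a b
  smooth_I : ∀ i, (UI i).Smooth a b
  density_E_pos : ∀ i, ∀ x ∈ Icc a b, 0 < (UE i).ρ x
  density_I_pos : ∀ i, ∀ x ∈ Icc a b, 0 < (UI i).ρ x
  stages : ∀ x ∈ Icc a b, tab.StageEquations Δt (U0.val x) (fun i => (UE i).val x)
    (fun i => (UI i).val x) (fun j => eulerRHS a b γ ε (UE j) (UI j) x)
  neumann_left : ∀ i, dx a b (pressure γ ε (UE i) (UI i)) a = 0
  neumann_right : ∀ i, dx a b (pressure γ ε (UE i) (UI i)) b = 0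
  update : ∀ x ∈ Icc a b,
    U1.val x = tab.update Δt (U0.val x) (fun j => eulerRHS a b γ ε (UE j) (UI j) x)

/-! ### Well-prepared data and the incompressible limit system -/

/-- Well-prepared initial density, velocity and pressure `ρ ε`, `u ε`, `p ε` on `[a, b]`: with a positive
constant `pStar`, a positive density `ρ₀`, a divergence-free velocity `u₀` and some `p₂`, as `ε → 0⁺`,
`ρ = ρ₀ + O(ε²)`, `u = u₀ + O(ε)`, `p = pStar + ε² p₂ + o(ε²)`, uniformly on `[a, b]` together with all
derivatives in `x`. -/
structure IsWellPrepared (a b pStar : ℝ) (ρ₀ u₀ : ℝ → ℝ) (ρ u p : ℝ → ℝ → ℝ) : Prop where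
  pStar_pos : 0 < pStar
  ρ₀_smooth : ContDiffOn ℝ ∞ ρ₀ (Icc a b)
  ρ₀_pos : ∀ x ∈ Icc a b, 0 < ρ₀ x
  u₀_smooth : ContDiffOn ℝ ∞ u₀ (Icc a b)
  u₀_divergenceFree : ∀ x ∈ Icc a b, dx a b u₀ x = 0
  ρ_smooth : ∀ᶠ ε in 𝓝[>] (0 : ℝ), ContDiffOn ℝ ∞ (ρ ε) (Icc a b)
  u_smooth : ∀ᶠ ε in 𝓝[>] (0 : ℝ), ContDiffOn ℝ ∞ (u ε) (Icc a b)
  p_smooth : ∀ᶠ ε in 𝓝[>] (0 : ℝ), ContDiffOn ℝ ∞ (p ε) (Icc a b)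
  ρ_expansion : ∀ k : ℕ, ∃ C : ℝ, ∀ᶠ ε in 𝓝[>] (0 : ℝ), ∀ x ∈ Icc a b,
    |iteratedDerivWithin k (fun y => ρ ε y - ρ₀ y) (Icc a b) x| ≤ C * ε ^ 2
  u_expansion : ∀ k : ℕ, ∃ C : ℝ, ∀ᶠ ε in 𝓝[>] (0 : ℝ), ∀ x ∈ Icc a b,
    |iteratedDerivWithin k (fun y => u ε y - u₀ y) (Icc a b) x| ≤ C * ε
  p_expansion : ∃ p₂ : ℝ → ℝ, ContDiffOn ℝ ∞ p₂ (Icc a b) ∧ ∀ k : ℕ, ∀ c > 0,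
    ∀ᶠ ε in 𝓝[>] (0 : ℝ), ∀ x ∈ Icc a b,
      |iteratedDerivWithin k (fun y => p ε y - pStar - ε ^ 2 * p₂ y) (Icc a b) x| ≤ c * ε ^ 2

/-- A smooth solution on `[0, T] × [a, b]` of the incompressible Euler system
`p = const`, `∇·u = 0`, `ρ_t + ∇·(ρ u) = 0`, `(ρ u)_t + ∇·(ρ u ⊗ u) + ∇p₂ = 0`,
with zero Neumann condition for the hydrodynamic pressure `p₂`. Arguments are time, then space. -/
structure IsIncompressibleSolution (a b T : ℝ) (ρ u p p₂ : ℝ → ℝ → ℝ) : Prop where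
  ρ_smooth : ContDiffOn ℝ ∞ (fun z : ℝ × ℝ => ρ z.1 z.2) (Icc 0 T ×ˢ Icc a b)
  u_smooth : ContDiffOn ℝ ∞ (fun z : ℝ × ℝ => u z.1 z.2) (Icc 0 T ×ˢ Icc a b)
  p₂_smooth : ContDiffOn ℝ ∞ (fun z : ℝ × ℝ => p₂ z.1 z.2) (Icc 0 T ×ˢ Icc a b)
  ρ_pos : ∀ t ∈ Icc 0 T, ∀ x ∈ Icc a b, 0 < ρ t x
  p_const : ∃ c : ℝ, ∀ t ∈ Icc 0 T, ∀ x ∈ Icc a b, p t x = c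
  divergenceFree : ∀ t ∈ Icc 0 T, ∀ x ∈ Icc a b, dx a b (u t) x = 0
  mass : ∀ t ∈ Icc 0 T, ∀ x ∈ Icc a b,
    derivWithin (fun τ => ρ τ x) (Icc 0 T) t + dx a b (fun y => ρ t y * u t y) x = 0
  momentum : ∀ t ∈ Icc 0 T, ∀ x ∈ Icc a b,
    derivWithin (fun τ => ρ τ x * u τ x) (Icc 0 T) t
      + dx a b (fun y => ρ t y * u t y * u t y) x + dx a b (p₂ t) x = 0
  neumann_left : ∀ t ∈ Icc 0 T, dx a b (p₂ t) a = 0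
  neumann_right : ∀ t ∈ Icc 0 T, dx a b (p₂ t) b = 0

/-- As `ε → 0⁺`, `p¹(x; ε) → pStar` and `∇·u¹(x; ε) → 0`, uniformly on `[a, b]`, where `p¹` is the pressure
of the numerical solution `U1 ε` by the equation of state. -/
def IncompressibleLimit (a b γ pStar : ℝ) (U1 : ℝ → Fields) : Prop :=
  TendstoUniformlyOn (fun ε => pressure γ ε (U1 ε) (U1 ε)) (fun _ => pStar) (𝓝[>] 0) (Icc a b) ∧
  TendstoUniformlyOn (fun ε => dx a b (U1 ε).u) (fun _ => 0) (𝓝[>] 0) (Icc a b)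

end SIIMEX

end

/-!
In one space dimension a divergence-free velocity is constant in space, and the momentum balance
with the Neumann condition for the hydrodynamic pressure makes it constant in time. Incompressible
flow is therefore transport of the density with a constant velocity `c`, and the scheme should
reduce, as `ε → 0⁺`, to its explicit part applied to `ρ_t + c ρ_x = 0`.

This is proved stage by stage, in the topology of `C^∞([a, b])` since every stage differentiates
the previous ones. Suppose that all earlier right-hand sides converge to states of the form
`(κ, c κ, 0)`. Then the explicit stage `U_E` tends to `(R, c R, e)` with a constant `e`.
Elimination of momentum and energy from the implicit stage leaves an elliptic equation for its
pressure. For the product `w` of the specific enthalpy `(E_E + p_E) / ρ_I` and the scaled pressure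
gradient `(1 - ε²)/ε² ∂ₓp_I` it reads `w'' = A w + F`, with `A = O(ε²)`; the Neumann condition
gives `w(a) = w(b) = 0`, and `F → 0` because the enthalpy flux `(E_E + p_E) / ρ_I · c ρ_I` of the
limit is constant. Since `w` is controlled by `w''`, it tends to `0` with all derivatives
(`smoothTendsto_zero_of_dirichlet`), and the current right-hand side converges to
`(-c R', -c² R', 0)` (`stateTendsto_eulerRHS`). By stiff accuracy the new value is the last
implicit stage (`step_limit`). No sign condition on the tableau enters, only `a_ii ≠ 0`.

Positivity of the limiting densities comes from the uniform lower bound in the first part, and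
from the smallness of `Δt` in the second, as the limiting densities tend to `ρ₀` with `Δt`
(`eventually_limitDensity_pos`).

For the error estimate, the limiting density after one step is the stability polynomial of the
explicit part in `-Δt c ∂ₓ`, applied to `ρ₀`. The scheme for `U' = U` shows that order `r` forces
the coefficients `1 / k!` for `k ≤ r` (`Tableau.HasOrder.stabilityCoeff_eq`), and these are the
Taylor coefficients in time of the exact density (`transport_taylor`). The momentum is `c` times
the density, on both sides.
-/

namespace SIIMEX

/-! ### Differentiation on a closed interval -/

section Dx

variable {a b : ℝ} {f g : ℝ → ℝ}

theorem dx_congr (h : EqOn f g (Icc a b)) : EqOn (dx a b f) (dx a b g) (Icc a b) :=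
  fun _ hx => derivWithin_congr h (h hx)

theorem contDiffOn_dx (hab : a < b) (hf : ContDiffOn ℝ ∞ f (Icc a b)) :
    ContDiffOn ℝ ∞ (dx a b f) (Icc a b) :=
  hf.derivWithin (uniqueDiffOn_Icc hab) (by simp)

theorem hasDerivWithinAt_dx (hf : ContDiffOn ℝ ∞ f (Icc a b)) {x : ℝ} (hx : x ∈ Icc a b) :
    HasDerivWithinAt f (dx a b f x) (Icc a b) x :=
  (hf.differentiableOn (by simp) x hx).hasDerivWithinAt

theorem dx_eq_of_hasDerivWithinAt (hab : a < b) {x c : ℝ} (hx : x ∈ Icc a b)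
    (h : HasDerivWithinAt f c (Icc a b) x) : dx a b f x = c :=
  h.derivWithin (uniqueDiffOn_Icc hab x hx)

theorem dx_add (hab : a < b) (hf : ContDiffOn ℝ ∞ f (Icc a b)) (hg : ContDiffOn ℝ ∞ g (Icc a b)) :
    EqOn (dx a b (fun x => f x + g x)) (fun x => dx a b f x + dx a b g x) (Icc a b) :=
  fun _ hx => dx_eq_of_hasDerivWithinAt hab hx
    ((hasDerivWithinAt_dx hf hx).add (hasDerivWithinAt_dx hg hx))

theorem dx_mul (hab : a < b) (hf : ContDiffOn ℝ ∞ f (Icc a b)) (hg : ContDiffOn ℝ ∞ g (Icc a b)) :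
    EqOn (dx a b (fun x => f x * g x)) (fun x => dx a b f x * g x + f x * dx a b g x) (Icc a b) :=
  fun _ hx => dx_eq_of_hasDerivWithinAt hab hx
    ((hasDerivWithinAt_dx hf hx).mul (hasDerivWithinAt_dx hg hx))

theorem dx_inv (hab : a < b) (hf : ContDiffOn ℝ ∞ f (Icc a b)) (h0 : ∀ x ∈ Icc a b, f x ≠ 0) :
    EqOn (dx a b (fun x => (f x)⁻¹)) (fun x => -1 * dx a b f x * ((f x)⁻¹ * (f x)⁻¹))
      (Icc a b) := by
  intro x hx
  refine dx_eq_of_hasDerivWithinAt hab hx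
    (((hasDerivWithinAt_dx hf hx).inv (h0 x hx)).congr_deriv ?_)
  field_simp

theorem dx_const (c : ℝ) : dx a b (fun _ => c) = fun _ => 0 := by
  funext x; simp [dx]

theorem dx_const_mul (c : ℝ) (f : ℝ → ℝ) : dx a b (fun x => c * f x) = fun x => c * dx a b f x := by
  funext x; exact derivWithin_const_mul_field c

theorem contDiffOn_iterate_dx (hab : a < b) (hf : ContDiffOn ℝ ∞ f (Icc a b)) (k : ℕ) :
    ContDiffOn ℝ ∞ ((dx a b)^[k] f) (Icc a b) := by
  induction k with
  | zero => exact hf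
  | succ k ih => rw [Function.iterate_succ_apply']; exact contDiffOn_dx hab ih

theorem iterate_dx_congr (h : EqOn f g (Icc a b)) (k : ℕ) :
    EqOn ((dx a b)^[k] f) ((dx a b)^[k] g) (Icc a b) := by
  induction k with
  | zero => exact h
  | succ k ih => simp only [Function.iterate_succ_apply']; exact dx_congr ih

theorem eq_left_of_dx_eq_zero (hf : ContDiffOn ℝ ∞ f (Icc a b)) (h : ∀ x ∈ Icc a b, dx a b f x = 0)
    {x : ℝ} (hx : x ∈ Icc a b) : f x = f a := by
  refine constant_of_derivWithin_zero (hf.differentiableOn (by simp)) (fun y hy => ?_) x hx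
  exact h y (Ico_subset_Icc_self hy)

/-- A mean value estimate that starts from any zero of `f`. -/
theorem abs_le_of_abs_dx_le (hf : ContDiffOn ℝ ∞ f (Icc a b)) {C x₀ : ℝ} (hx₀ : x₀ ∈ Icc a b)
    (h0 : f x₀ = 0) (h : ∀ x ∈ Icc a b, |dx a b f x| ≤ C) {x : ℝ} (hx : x ∈ Icc a b) :
    |f x| ≤ C * (b - a) := by
  have h1 := (convex_Icc a b).norm_image_sub_le_of_norm_derivWithin_le
    (hf.differentiableOn (by simp)) h hx₀ hx
  rw [h0, sub_zero, Real.norm_eq_abs, Real.norm_eq_abs] at h1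
  have hC : 0 ≤ C := (abs_nonneg _).trans (h x hx)
  refine h1.trans (mul_le_mul_of_nonneg_left ?_ hC)
  rw [abs_le]; constructor <;> linarith [hx.1, hx.2, hx₀.1, hx₀.2]

/-- If `f` vanishes at both end points, then `f` and `f'` are controlled by `f''`. -/
theorem dirichlet_bounds (hab : a < b) (hf : ContDiffOn ℝ ∞ f (Icc a b)) (ha : f a = 0)
    (hb : f b = 0) {C : ℝ} (h : ∀ x ∈ Icc a b, |dx a b (dx a b f) x| ≤ C) {x : ℝ}
    (hx : x ∈ Icc a b) : |dx a b f x| ≤ C * (b - a) ∧ |f x| ≤ C * (b - a) * (b - a) := by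
  obtain ⟨c, hc, hc0⟩ := exists_deriv_eq_zero hab hf.continuousOn (ha.trans hb.symm)
  have hd : dx a b f c = 0 := by
    rw [dx, derivWithin_of_mem_nhds (Icc_mem_nhds hc.1 hc.2), hc0]
  have h1 : ∀ y ∈ Icc a b, |dx a b f y| ≤ C * (b - a) := fun y hy =>
    abs_le_of_abs_dx_le (contDiffOn_dx hab hf) (Ioo_subset_Icc_self hc) hd h hy
  exact ⟨h1 x hx, abs_le_of_abs_dx_le hf (left_mem_Icc.2 hab.le) ha h1 hx⟩

end Dx

/-! ### Uniform convergence together with derivatives -/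

section Convergence

variable {ι : Type*} {l : Filter ι} {a b : ℝ}

/-- Convergence `f i → g` in `C^n([a, b])` along the filter `l`, for families of functions that
are eventually smooth on `[a, b]`, with a smooth limit. -/
structure CTendsto (l : Filter ι) (a b : ℝ) (n : ℕ) (f : ι → ℝ → ℝ) (g : ℝ → ℝ) : Prop where
  smooth : ∀ᶠ i in l, ContDiffOn ℝ ∞ (f i) (Icc a b)
  smooth_lim : ContDiffOn ℝ ∞ g (Icc a b)
  tendsto : ∀ k ≤ n, TendstoUniformlyOn (fun i => (dx a b)^[k] (f i)) ((dx a b)^[k] g) l (Icc a b)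

/-- Convergence `f i → g` in `C^∞([a, b])` along the filter `l`. -/
def SmoothTendsto (l : Filter ι) (a b : ℝ) (f : ι → ℝ → ℝ) (g : ℝ → ℝ) : Prop :=
  ∀ n, CTendsto l a b n f g

theorem SmoothTendsto.smooth {f : ι → ℝ → ℝ} {g : ℝ → ℝ} (h : SmoothTendsto l a b f g) :
    ∀ᶠ i in l, ContDiffOn ℝ ∞ (f i) (Icc a b) := (h 0).smooth

theorem SmoothTendsto.smooth_lim {f : ι → ℝ → ℝ} {g : ℝ → ℝ} (h : SmoothTendsto l a b f g) :
    ContDiffOn ℝ ∞ g (Icc a b) := (h 0).smooth_lim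

theorem SmoothTendsto.uniform {f : ι → ℝ → ℝ} {g : ℝ → ℝ} (h : SmoothTendsto l a b f g) :
    TendstoUniformlyOn f g l (Icc a b) := (h 0).tendsto 0 le_rfl

theorem CTendsto.mono {n m : ℕ} {f : ι → ℝ → ℝ} {g : ℝ → ℝ} (h : CTendsto l a b n f g)
    (hm : m ≤ n) : CTendsto l a b m f g :=
  ⟨h.smooth, h.smooth_lim, fun k hk => h.tendsto k (hk.trans hm)⟩

theorem CTendsto.congr {n : ℕ} {f f' : ι → ℝ → ℝ} {g g' : ℝ → ℝ} (h : CTendsto l a b n f g)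
    (hf : ∀ᶠ i in l, EqOn (f i) (f' i) (Icc a b)) (hg : EqOn g g' (Icc a b)) :
    CTendsto l a b n f' g' := by
  refine ⟨?_, h.smooth_lim.congr fun x hx => (hg hx).symm, fun k hk => ?_⟩
  · filter_upwards [h.smooth, hf] with i hi hi' using hi.congr fun x hx => (hi' hx).symm
  · refine ((h.tendsto k hk).congr ?_).congr_right (iterate_dx_congr hg k)
    filter_upwards [hf] with i hi using iterate_dx_congr hi k

theorem SmoothTendsto.congr {f f' : ι → ℝ → ℝ} {g g' : ℝ → ℝ} (h : SmoothTendsto l a b f g)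
    (hf : ∀ᶠ i in l, EqOn (f i) (f' i) (Icc a b)) (hg : EqOn g g' (Icc a b)) :
    SmoothTendsto l a b f' g' := fun n => (h n).congr hf hg

theorem CTendsto.zero {f : ι → ℝ → ℝ} {g : ℝ → ℝ}
    (hf : ∀ᶠ i in l, ContDiffOn ℝ ∞ (f i) (Icc a b)) (hg : ContDiffOn ℝ ∞ g (Icc a b))
    (h : TendstoUniformlyOn f g l (Icc a b)) : CTendsto l a b 0 f g :=
  ⟨hf, hg, fun _ hk => Nat.le_zero.1 hk ▸ h⟩

/-- Convergence in `C^(n+1)` is uniform convergence together with convergence of the derivatives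
in `C^n`. -/
theorem CTendsto.succ {n : ℕ} {f : ι → ℝ → ℝ} {g : ℝ → ℝ}
    (hf : ∀ᶠ i in l, ContDiffOn ℝ ∞ (f i) (Icc a b)) (hg : ContDiffOn ℝ ∞ g (Icc a b))
    (h : TendstoUniformlyOn f g l (Icc a b))
    (h' : CTendsto l a b n (fun i => dx a b (f i)) (dx a b g)) : CTendsto l a b (n + 1) f g := by
  refine ⟨hf, hg, fun k hk => ?_⟩
  cases k with
  | zero => exact h
  | succ k =>
    simp only [Function.iterate_succ_apply]
    exact h'.tendsto k (by omega)

theorem CTendsto.dx (hab : a < b) {n : ℕ} {f : ι → ℝ → ℝ} {g : ℝ → ℝ}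
    (h : CTendsto l a b (n + 1) f g) :
    CTendsto l a b n (fun i => dx a b (f i)) (dx a b g) := by
  refine ⟨h.smooth.mono fun i hi => contDiffOn_dx hab hi, contDiffOn_dx hab h.smooth_lim,
    fun k hk => ?_⟩
  have := h.tendsto (k + 1) (by omega)
  simpa only [Function.iterate_succ_apply] using this

theorem SmoothTendsto.dx (hab : a < b) {f : ι → ℝ → ℝ} {g : ℝ → ℝ} (h : SmoothTendsto l a b f g) :
    SmoothTendsto l a b (fun i => dx a b (f i)) (dx a b g) := fun n => (h (n + 1)).dx hab

theorem SmoothTendsto.of_const {g : ℝ → ℝ} (hg : ContDiffOn ℝ ∞ g (Icc a b)) :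
    SmoothTendsto l a b (fun _ => g) g :=
  fun _ => ⟨Eventually.of_forall fun _ => hg, hg, fun _ _ =>
    fun _ hu => Eventually.of_forall fun _ _ _ => refl_mem_uniformity hu⟩

theorem SmoothTendsto.scalar {c : ι → ℝ} {c₀ : ℝ} (hc : Tendsto c l (𝓝 c₀)) :
    SmoothTendsto l a b (fun i _ => c i) (fun _ => c₀) := by
  intro n
  have hs : ∀ᶠ i in l, ContDiffOn ℝ ∞ (fun _ : ℝ => c i) (Icc a b) :=
    Eventually.of_forall fun _ => contDiffOn_const
  have hu : TendstoUniformlyOn (fun i (_ : ℝ) => c i) (fun _ => c₀) l (Icc a b) :=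
    hc.tendstoUniformlyOn_const _
  cases n with
  | zero => exact .zero hs contDiffOn_const hu
  | succ n =>
    refine .succ hs contDiffOn_const hu ?_
    simp only [dx_const]
    exact SmoothTendsto.of_const contDiffOn_const n

theorem CTendsto.add (hab : a < b) {n : ℕ} {f₁ f₂ : ι → ℝ → ℝ} {g₁ g₂ : ℝ → ℝ}
    (h₁ : CTendsto l a b n f₁ g₁) (h₂ : CTendsto l a b n f₂ g₂) :
    CTendsto l a b n (fun i x => f₁ i x + f₂ i x) (fun x => g₁ x + g₂ x) := by
  induction n generalizing f₁ f₂ g₁ g₂ with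
  | zero =>
    refine .zero ?_ (h₁.smooth_lim.add h₂.smooth_lim)
      ((h₁.tendsto 0 le_rfl).add (h₂.tendsto 0 le_rfl))
    filter_upwards [h₁.smooth, h₂.smooth] with i hi hi' using hi.add hi'
  | succ n ih =>
    refine .succ ?_ (h₁.smooth_lim.add h₂.smooth_lim)
      ((h₁.tendsto 0 (by omega)).add (h₂.tendsto 0 (by omega))) ?_
    · filter_upwards [h₁.smooth, h₂.smooth] with i hi hi' using hi.add hi'
    · refine (ih (h₁.dx hab) (h₂.dx hab)).congr ?_ (dx_add hab h₁.smooth_lim h₂.smooth_lim).symm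
      filter_upwards [h₁.smooth, h₂.smooth] with i hi hi' using (dx_add hab hi hi').symm

theorem tendstoUniformlyOn_mul {f₁ f₂ : ι → ℝ → ℝ} {g₁ g₂ : ℝ → ℝ}
    (hg₁ : ContinuousOn g₁ (Icc a b)) (hg₂ : ContinuousOn g₂ (Icc a b))
    (h₁ : TendstoUniformlyOn f₁ g₁ l (Icc a b)) (h₂ : TendstoUniformlyOn f₂ g₂ l (Icc a b)) :
    TendstoUniformlyOn (fun i x => f₁ i x * f₂ i x) (fun x => g₁ x * g₂ x) l (Icc a b) :=
  (tendstoLocallyUniformlyOn_iff_tendstoUniformlyOn_of_compact isCompact_Icc).1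
    (h₁.tendstoLocallyUniformlyOn.mul₀ h₂.tendstoLocallyUniformlyOn hg₁ hg₂)

theorem tendstoUniformlyOn_inv {f : ι → ℝ → ℝ} {g : ℝ → ℝ} (hg : ContinuousOn g (Icc a b))
    (h0 : ∀ x ∈ Icc a b, g x ≠ 0) (h : TendstoUniformlyOn f g l (Icc a b)) :
    TendstoUniformlyOn (fun i x => (f i x)⁻¹) (fun x => (g x)⁻¹) l (Icc a b) :=
  (tendstoLocallyUniformlyOn_iff_tendstoUniformlyOn_of_compact isCompact_Icc).1
    (h.tendstoLocallyUniformlyOn.inv₀ hg h0)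

theorem CTendsto.mul (hab : a < b) {n : ℕ} {f₁ f₂ : ι → ℝ → ℝ} {g₁ g₂ : ℝ → ℝ}
    (h₁ : CTendsto l a b n f₁ g₁) (h₂ : CTendsto l a b n f₂ g₂) :
    CTendsto l a b n (fun i x => f₁ i x * f₂ i x) (fun x => g₁ x * g₂ x) := by
  induction n generalizing f₁ f₂ g₁ g₂ with
  | zero =>
    refine .zero ?_ (h₁.smooth_lim.mul h₂.smooth_lim) (tendstoUniformlyOn_mul
      h₁.smooth_lim.continuousOn h₂.smooth_lim.continuousOn (h₁.tendsto 0 le_rfl)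
      (h₂.tendsto 0 le_rfl))
    filter_upwards [h₁.smooth, h₂.smooth] with i hi hi' using hi.mul hi'
  | succ n ih =>
    refine .succ ?_ (h₁.smooth_lim.mul h₂.smooth_lim) (tendstoUniformlyOn_mul
      h₁.smooth_lim.continuousOn h₂.smooth_lim.continuousOn (h₁.tendsto 0 (by omega))
      (h₂.tendsto 0 (by omega))) ?_
    · filter_upwards [h₁.smooth, h₂.smooth] with i hi hi' using hi.mul hi'
    · refine ((ih (h₁.dx hab) (h₂.mono n.le_succ)).add hab (ih (h₁.mono n.le_succ)
        (h₂.dx hab))).congr ?_ (dx_mul hab h₁.smooth_lim h₂.smooth_lim).symm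
      filter_upwards [h₁.smooth, h₂.smooth] with i hi hi' using (dx_mul hab hi hi').symm

theorem eventually_pos_of_tendstoUniformlyOn {f : ι → ℝ → ℝ} {g : ℝ → ℝ}
    (hg : ContinuousOn g (Icc a b)) (h0 : ∀ x ∈ Icc a b, 0 < g x)
    (h : TendstoUniformlyOn f g l (Icc a b)) : ∀ᶠ i in l, ∀ x ∈ Icc a b, 0 < f i x := by
  rcases (Icc a b).eq_empty_or_nonempty with he | hne
  · simp [he]
  obtain ⟨x₀, hx₀, hmin⟩ := isCompact_Icc.exists_isMinOn hne hg
  filter_upwards [Metric.tendstoUniformlyOn_iff.1 h (g x₀) (h0 x₀ hx₀)] with i hi x hx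
  have h1 := hi x hx
  rw [Real.dist_eq, abs_lt] at h1
  have h2 : g x₀ ≤ g x := hmin hx
  linarith [h1.2]

theorem CTendsto.inv (hab : a < b) {n : ℕ} {f : ι → ℝ → ℝ} {g : ℝ → ℝ}
    (h : CTendsto l a b n f g) (h0 : ∀ x ∈ Icc a b, 0 < g x) :
    CTendsto l a b n (fun i x => (f i x)⁻¹) (fun x => (g x)⁻¹) := by
  have hu := h.tendsto 0 (Nat.zero_le n)
  have hpos := eventually_pos_of_tendstoUniformlyOn h.smooth_lim.continuousOn h0 hu
  have hui := tendstoUniformlyOn_inv h.smooth_lim.continuousOn (fun x hx => (h0 x hx).ne') hu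
  have hs : ∀ᶠ i in l, ContDiffOn ℝ ∞ (fun x => (f i x)⁻¹) (Icc a b) := by
    filter_upwards [h.smooth, hpos] with i hi hi' using hi.inv fun x hx => (hi' x hx).ne'
  have hg := h.smooth_lim.inv fun x hx => (h0 x hx).ne'
  induction n with
  | zero => exact .zero hs hg hui
  | succ n ih =>
    have hi := ih (h.mono n.le_succ)
    refine .succ hs hg hui (((((SmoothTendsto.of_const contDiffOn_const (g := fun _ => -1) n).mul
      hab (h.dx hab)).mul hab (hi.mul hab hi))).congr ?_
      (dx_inv hab h.smooth_lim fun x hx => (h0 x hx).ne').symm)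
    filter_upwards [h.smooth, hpos] with i hi hi' using
      (dx_inv hab hi fun x hx => (hi' x hx).ne').symm

namespace SmoothTendsto

variable {f f₁ f₂ : ι → ℝ → ℝ} {g g₁ g₂ : ℝ → ℝ}

theorem add (hab : a < b) (h₁ : SmoothTendsto l a b f₁ g₁) (h₂ : SmoothTendsto l a b f₂ g₂) :
    SmoothTendsto l a b (fun i x => f₁ i x + f₂ i x) (fun x => g₁ x + g₂ x) :=
  fun n => (h₁ n).add hab (h₂ n)

theorem mul (hab : a < b) (h₁ : SmoothTendsto l a b f₁ g₁) (h₂ : SmoothTendsto l a b f₂ g₂) :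
    SmoothTendsto l a b (fun i x => f₁ i x * f₂ i x) (fun x => g₁ x * g₂ x) :=
  fun n => (h₁ n).mul hab (h₂ n)

theorem scalar_mul (hab : a < b) {c : ι → ℝ} {c₀ : ℝ} (hc : Tendsto c l (𝓝 c₀))
    (h : SmoothTendsto l a b f g) :
    SmoothTendsto l a b (fun i x => c i * f i x) (fun x => c₀ * g x) :=
  (SmoothTendsto.scalar hc).mul hab h

theorem const_mul (hab : a < b) (c : ℝ) (h : SmoothTendsto l a b f g) :
    SmoothTendsto l a b (fun i x => c * f i x) (fun x => c * g x) :=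
  h.scalar_mul hab tendsto_const_nhds

theorem neg (hab : a < b) (h : SmoothTendsto l a b f g) :
    SmoothTendsto l a b (fun i x => -f i x) (fun x => -g x) := by
  simpa using h.const_mul hab (-1)

theorem sub (hab : a < b) (h₁ : SmoothTendsto l a b f₁ g₁) (h₂ : SmoothTendsto l a b f₂ g₂) :
    SmoothTendsto l a b (fun i x => f₁ i x - f₂ i x) (fun x => g₁ x - g₂ x) := by
  simpa only [sub_eq_add_neg] using h₁.add hab (h₂.neg hab)

theorem div (hab : a < b) (h₁ : SmoothTendsto l a b f₁ g₁) (h₂ : SmoothTendsto l a b f₂ g₂)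
    (h0 : ∀ x ∈ Icc a b, 0 < g₂ x) :
    SmoothTendsto l a b (fun i x => f₁ i x / f₂ i x) (fun x => g₁ x / g₂ x) := by
  simp only [div_eq_mul_inv]
  exact fun n => (h₁ n).mul hab ((h₂ n).inv hab h0)

theorem finset_sum (hab : a < b) {J : Type*} (S : Finset J) {F : J → ι → ℝ → ℝ} {G : J → ℝ → ℝ}
    (h : ∀ j ∈ S, SmoothTendsto l a b (F j) (G j)) :
    SmoothTendsto l a b (fun i x => ∑ j ∈ S, F j i x) (fun x => ∑ j ∈ S, G j x) := by
  classical
  induction S using Finset.induction_on with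
  | empty =>
    simpa using SmoothTendsto.of_const (l := l) (a := a) (b := b) (g := fun _ => 0) contDiffOn_const
  | insert j S hj ih =>
    simp only [Finset.sum_insert hj]
    exact (h j (by simp)).add hab (ih fun k hk => h k (by simp [hk]))

end SmoothTendsto

/-! ### Singularly perturbed Dirichlet problems -/

theorem tendstoUniformlyOn_zero_iff {f : ι → ℝ → ℝ} :
    TendstoUniformlyOn f (fun _ => 0) l (Icc a b) ↔
      ∀ δ > 0, ∀ᶠ i in l, ∀ x ∈ Icc a b, |f i x| < δ := by
  rw [Metric.tendstoUniformlyOn_iff]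
  simp only [dist_zero_left, Real.norm_eq_abs]

/-- Solutions of `w'' = A w + F`, `w(a) = w(b) = 0` tend to `0` in `C^∞` when `A` and `F` do.
Since `w` and `w'` are controlled by `w''`, the term `A w` is absorbed as soon as `A` is small;
the higher derivatives follow from the equation. -/
theorem smoothTendsto_zero_of_dirichlet (hab : a < b) {w A F : ι → ℝ → ℝ}
    (hw : ∀ᶠ i in l, ContDiffOn ℝ ∞ (w i) (Icc a b))
    (ha : ∀ᶠ i in l, w i a = 0) (hb : ∀ᶠ i in l, w i b = 0)
    (hA : SmoothTendsto l a b A (fun _ => 0)) (hF : SmoothTendsto l a b F (fun _ => 0))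
    (heq : ∀ᶠ i in l, ∀ x ∈ Icc a b, dx a b (dx a b (w i)) x = A i x * w i x + F i x) :
    SmoothTendsto l a b w (fun _ => 0) := by
  have hL : 0 < b - a := sub_pos.2 hab
  set L := b - a with hLdef
  have key : ∀ δ > 0, ∀ᶠ i in l, ∀ x ∈ Icc a b,
      |dx a b (w i) x| ≤ δ * L ∧ |w i x| ≤ δ * L * L := by
    intro δ hδ
    have hA' := tendstoUniformlyOn_zero_iff.1 hA.uniform (1 / (2 * (L * L))) (by positivity)
    have hF' := tendstoUniformlyOn_zero_iff.1 hF.uniform (δ / 2) (by positivity)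
    filter_upwards [hw, ha, hb, heq, hA', hF'] with i hwi hai hbi hei hAi hFi
    obtain ⟨x₀, hx₀, hmax⟩ := isCompact_Icc.exists_isMaxOn (nonempty_Icc.2 hab.le)
      hwi.continuousOn.abs
    have hM : ∀ x ∈ Icc a b, |w i x| ≤ |w i x₀| := fun x hx => hmax hx
    set M := |w i x₀|
    have h2 : ∀ x ∈ Icc a b, |dx a b (dx a b (w i)) x| ≤ 1 / (2 * (L * L)) * M + δ / 2 := by
      intro x hx
      rw [hei x hx]
      refine (abs_add_le _ _).trans (add_le_add ?_ (hFi x hx).le)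
      rw [abs_mul]
      exact mul_le_mul (hAi x hx).le (hM x hx) (abs_nonneg _) (by positivity)
    -- for this size of `A` at most half of `M` reappears on the right, and is absorbed
    have h3 : M ≤ (1 / (2 * (L * L)) * M + δ / 2) * L * L :=
      (dirichlet_bounds hab hwi hai hbi h2 hx₀).2
    have h4 : M ≤ δ * (L * L) := by
      have : (1 / (2 * (L * L)) * M + δ / 2) * L * L = M / 2 + δ / 2 * (L * L) := by field_simp
      rw [this] at h3; linarith
    have h5 : 1 / (2 * (L * L)) * M + δ / 2 ≤ δ := by
      have : 1 / (2 * (L * L)) * M ≤ 1 / (2 * (L * L)) * (δ * (L * L)) := by gcongr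
      have h6 : 1 / (2 * (L * L)) * (δ * (L * L)) = δ / 2 := by field_simp
      linarith
    intro x hx
    exact dirichlet_bounds hab hwi hai hbi (fun y hy => (h2 y hy).trans h5) hx
  -- `δ` is scaled so that the bounds of `key` fall below the required tolerance
  have hw0 : TendstoUniformlyOn w (fun _ => 0) l (Icc a b) := by
    rw [tendstoUniformlyOn_zero_iff]
    intro δ hδ
    filter_upwards [key (δ / (2 * L * L)) (by positivity)] with i hi x hx
    have h1 := (hi x hx).2
    have h2 : δ / (2 * L * L) * L * L = δ / 2 := by field_simp
    linarith
  have hw1 : TendstoUniformlyOn (fun i => dx a b (w i)) (fun _ => 0) l (Icc a b) := by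
    rw [tendstoUniformlyOn_zero_iff]
    intro δ hδ
    filter_upwards [key (δ / (2 * L)) (by positivity)] with i hi x hx
    have h1 := (hi x hx).1
    have h2 : δ / (2 * L) * L = δ / 2 := by field_simp
    linarith
  intro n
  -- convergence in `C^n` gives, through the equation, convergence of `w''` in `C^n`
  induction n with
  | zero => exact .zero hw contDiffOn_const hw0
  | succ n ih =>
    have h2 : CTendsto l a b n (fun i => dx a b (dx a b (w i))) (fun _ => 0) := by
      refine (((hA n).mul hab ih).add hab (hF n)).congr ?_ (fun x _ => by simp)
      filter_upwards [heq] with i hi x hx using (hi x hx).symm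
    have h1 : CTendsto l a b (n + 1) (fun i => dx a b (w i)) (fun _ => 0) := by
      refine .succ (hw.mono fun i hi => contDiffOn_dx hab hi) contDiffOn_const hw1 ?_
      rwa [dx_const]
    refine .succ hw contDiffOn_const hw0 ?_
    rw [dx_const]
    exact h1.mono n.le_succ

end Convergence

/-! ### The zero Mach number limit of one stage -/

section Stage

variable {a b c e γ : ℝ}

/-- The conserved variables `V ε` tend in `C^∞([a, b])`, as `ε → 0⁺`, to a state with density `R`,
momentum `c R` and constant energy `e`. Time derivatives of such states satisfy this with `e = 0`.
-/
structure StateTendsto (a b c : ℝ) (V : ℝ → ℝ → ℝ × ℝ × ℝ) (R : ℝ → ℝ) (e : ℝ) : Prop where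
  ρ : SmoothTendsto (𝓝[>] 0) a b (fun ε x => (V ε x).1) R
  q : SmoothTendsto (𝓝[>] 0) a b (fun ε x => (V ε x).2.1) (fun x => c * R x)
  E : SmoothTendsto (𝓝[>] 0) a b (fun ε x => (V ε x).2.2) (fun _ => e)

theorem StateTendsto.congr {V V' : ℝ → ℝ → ℝ × ℝ × ℝ} {R R' : ℝ → ℝ} (h : StateTendsto a b c V R e)
    (hV : ∀ᶠ ε in 𝓝[>] (0 : ℝ), EqOn (V ε) (V' ε) (Icc a b)) (hR : EqOn R R' (Icc a b)) :
    StateTendsto a b c V' R' e where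
  ρ := h.ρ.congr (hV.mono fun _ hε _ hx => congrArg Prod.fst (hε hx)) hR
  q := h.q.congr (hV.mono fun _ hε _ hx => congrArg (fun z => z.2.1) (hε hx))
    fun _ hx => congrArg (c * ·) (hR hx)
  E := h.E.congr (hV.mono fun _ hε _ hx => congrArg (fun z => z.2.2) (hε hx)) fun _ _ => rfl

theorem StateTendsto.add_smul_sum (hab : a < b) {J : Type*} (S : Finset J) (h : ℝ) (α : J → ℝ)
    {V : ℝ → ℝ → ℝ × ℝ × ℝ} {R : ℝ → ℝ} (hV : StateTendsto a b c V R e)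
    {K : J → ℝ → ℝ → ℝ × ℝ × ℝ} {κ : J → ℝ → ℝ} (hK : ∀ j ∈ S, StateTendsto a b c (K j) (κ j) 0) :
    StateTendsto a b c (fun ε x => V ε x + h • ∑ j ∈ S, α j • K j ε x)
      (fun x => R x + h * ∑ j ∈ S, α j * κ j x) e where
  ρ := (hV.ρ.add hab ((SmoothTendsto.finset_sum hab S fun j hj =>
      (hK j hj).ρ.const_mul hab (α j)).const_mul hab h)).congr
    (Eventually.of_forall fun ε x _ => by simp [Prod.fst_sum]) fun _ _ => rfl
  q := (hV.q.add hab ((SmoothTendsto.finset_sum hab S fun j hj =>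
      (hK j hj).q.const_mul hab (α j)).const_mul hab h)).congr
    (Eventually.of_forall fun ε x _ => by simp [Prod.fst_sum, Prod.snd_sum]) fun x _ => by
      simp only [mul_add, Finset.mul_sum]
      exact congrArg _ (Finset.sum_congr rfl fun j _ => by ring)
  E := (hV.E.add hab ((SmoothTendsto.finset_sum hab S fun j hj =>
      (hK j hj).E.const_mul hab (α j)).const_mul hab h)).congr
    (Eventually.of_forall fun ε x _ => by simp [Prod.snd_sum]) fun x _ => by simp

theorem tendsto_sq_nhdsGT_zero : Tendsto (fun ε : ℝ => ε ^ 2) (𝓝[>] 0) (𝓝 0) := by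
  have : Tendsto (fun ε : ℝ => ε ^ 2) (𝓝 0) (𝓝 (0 ^ 2)) := (continuous_pow 2).tendsto 0
  simpa using this.mono_left nhdsWithin_le_nhds

theorem eventually_small : ∀ᶠ ε in 𝓝[>] (0 : ℝ), 0 < ε ∧ ε < 1 :=
  Ioo_mem_nhdsGT one_pos

theorem eventually_splitting : ∀ᶠ ε in 𝓝[>] (0 : ℝ), splitting ε = 1 := by
  filter_upwards [eventually_small] with ε hε using if_pos hε.2

theorem smoothTendsto_kinetic (hab : a < b) {W : ℝ → Fields} {R : ℝ → ℝ}
    (hW : StateTendsto a b c (fun ε => (W ε).val) R e) (hR : ∀ x ∈ Icc a b, 0 < R x) :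
    SmoothTendsto (𝓝[>] 0) a b (fun ε y => ε ^ 2 * ((W ε).q y ^ 2 / (2 * (W ε).ρ y)))
      (fun _ => 0) := by
  have h1 := (((hW.q.mul hab hW.q).div hab (hW.ρ.const_mul hab 2)
    (fun x hx => mul_pos two_pos (hR x hx))).scalar_mul hab tendsto_sq_nhdsGT_zero)
  refine h1.congr (Eventually.of_forall fun ε x _ => ?_) fun x _ => by simp
  simp [Fields.val, pow_two]

/-- The pressure `p_Z`, with the kinetic energy of `W`, has the limit `(γ - 1) e`. -/
theorem smoothTendsto_pressure (hab : a < b) {W Z : ℝ → Fields} {R R' : ℝ → ℝ}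
    (hW : StateTendsto a b c (fun ε => (W ε).val) R e) (hR : ∀ x ∈ Icc a b, 0 < R x)
    (hZ : StateTendsto a b c (fun ε => (Z ε).val) R' e) :
    SmoothTendsto (𝓝[>] 0) a b (fun ε => pressure γ ε (W ε) (Z ε)) (fun _ => (γ - 1) * e) :=
  ((hZ.E.sub hab (smoothTendsto_kinetic hab hW hR)).const_mul hab (γ - 1)).congr
    (Eventually.of_forall fun _ _ _ => rfl) fun _ _ => by simp

/-- The explicit momentum flux of a state with velocity `c` and constant pressure has the limit
`c² R + p`. -/
theorem smoothTendsto_explicitFlux (hab : a < b) {W : ℝ → Fields} {R : ℝ → ℝ}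
    (hW : StateTendsto a b c (fun ε => (W ε).val) R e) (hR : ∀ x ∈ Icc a b, 0 < R x) :
    SmoothTendsto (𝓝[>] 0) a b
      (fun ε y => (W ε).q y * (W ε).q y / (W ε).ρ y + splitting ε * pressure γ ε (W ε) (W ε) y)
      (fun x => c * (c * R x) + (γ - 1) * e) := by
  have hs : Tendsto splitting (𝓝[>] 0) (𝓝 1) :=
    tendsto_const_nhds.congr' (eventually_splitting.mono fun _ h => h.symm)
  refine (((hW.q.mul hab hW.q).div hab hW.ρ hR).add hab
    ((smoothTendsto_pressure (γ := γ) hab hW hR hW).scalar_mul hab hs)).congr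
    (Eventually.of_forall fun _ _ _ => rfl) fun x hx => ?_
  have := (hR x hx).ne'
  field_simp

theorem dx_momentumFlux (p : ℝ) (R : ℝ → ℝ) :
    dx a b (fun x => c * (c * R x) + p) = fun x => c * (c * dx a b R x) := by
  have : dx a b (fun x => c * (c * R x) + p) = dx a b (fun x => c * (c * R x)) := by
    funext x; exact derivWithin_add_const p
  rw [this, dx_const_mul, dx_const_mul]

/-- If an explicit stage `W` has the constant velocity `c` and a constant pressure in the limit,
and the implicit stage `Z = V + k H(W, Z)` satisfies the Neumann condition, then the right-hand
side tends to `(κ, c κ, 0)` with `κ = -c R'`. Eliminating momentum and energy of `Z` leaves, for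
the product `w` of the specific enthalpy `(E_W + p_W) / ρ_Z` and the scaled pressure gradient, a
Dirichlet problem `w'' = A w + F` with `A = O(ε²)` and `F → 0`, so that `w → 0`. -/
theorem stateTendsto_eulerRHS (hab : a < b) (hγ : 1 < γ) (he : 0 < e) {k : ℝ} (hk : k ≠ 0)
    {V : ℝ → ℝ → ℝ × ℝ × ℝ} {W Z : ℝ → Fields} {R S : ℝ → ℝ}
    (hV : StateTendsto a b c V S e) (hW : StateTendsto a b c (fun ε => (W ε).val) R e)
    (hR : ∀ x ∈ Icc a b, 0 < R x)
    {RZ : ℝ → ℝ} (hZρ : SmoothTendsto (𝓝[>] 0) a b (fun ε => (Z ε).ρ) RZ)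
    (hRZ : ∀ x ∈ Icc a b, 0 < RZ x)
    (hRZeq : ∀ x ∈ Icc a b, RZ x = S x + k * (-(c * dx a b R x)))
    (hZ : ∀ᶠ ε in 𝓝[>] (0 : ℝ), (Z ε).Smooth a b)
    (hstage : ∀ᶠ ε in 𝓝[>] (0 : ℝ), ∀ x ∈ Icc a b,
      (Z ε).val x = V ε x + k • eulerRHS a b γ ε (W ε) (Z ε) x)
    (hNa : ∀ᶠ ε in 𝓝[>] (0 : ℝ), dx a b (pressure γ ε (W ε) (Z ε)) a = 0)
    (hNb : ∀ᶠ ε in 𝓝[>] (0 : ℝ), dx a b (pressure γ ε (W ε) (Z ε)) b = 0) :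
    StateTendsto a b c (fun ε => eulerRHS a b γ ε (W ε) (Z ε)) (fun x => -(c * dx a b R x)) 0 := by
  have hkin := smoothTendsto_kinetic hab hW hR
  have hflux := smoothTendsto_explicitFlux (γ := γ) hab hW hR
  -- the specific enthalpy
  set H : ℝ → ℝ → ℝ := fun ε y => ((W ε).E y + pressure γ ε (W ε) (W ε) y) / (Z ε).ρ y with hHdef
  have hH : SmoothTendsto (𝓝[>] 0) a b H (fun x => (e + (γ - 1) * e) / RZ x) :=
    (hW.E.add hab (smoothTendsto_pressure (γ := γ) hab hW hR hW)).div hab hZρ hRZ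
  have hH0 : ∀ x ∈ Icc a b, 0 < (e + (γ - 1) * e) / RZ x := fun x hx =>
    div_pos (by nlinarith) (hRZ x hx)
  have hHpos := eventually_pos_of_tendstoUniformlyOn hH.smooth_lim.continuousOn hH0 hH.uniform
  have hHinv : SmoothTendsto (𝓝[>] 0) a b (fun ε x => (H ε x)⁻¹)
      (fun x => ((e + (γ - 1) * e) / RZ x)⁻¹) := fun n => (hH n).inv hab hH0
  -- the momentum of `Z` without the contribution of its own pressure
  set Q : ℝ → ℝ → ℝ := fun ε y => (V ε y).2.1 - k * dx a b (fun y =>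
    (W ε).q y * (W ε).q y / (W ε).ρ y + splitting ε * pressure γ ε (W ε) (W ε) y) y with hQdef
  have hQ : SmoothTendsto (𝓝[>] 0) a b Q (fun x => c * RZ x) := by
    refine (hV.q.sub hab ((hflux.dx hab).const_mul hab k)).congr
      (Eventually.of_forall fun _ _ _ => rfl) fun x hx => ?_
    simp only [dx_momentumFlux, hRZeq x hx]
    ring
  have hHQ : SmoothTendsto (𝓝[>] 0) a b (fun ε x => H ε x * Q ε x)
      (fun _ => (e + (γ - 1) * e) * c) := by
    refine (hH.mul hab hQ).congr (Eventually.of_forall fun _ _ _ => rfl) fun x hx => ?_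
    have := (hRZ x hx).ne'
    field_simp
  -- the scaled pressure gradient
  set G : ℝ → ℝ → ℝ := fun ε => dx a b (fun y => (1 - splitting ε * ε ^ 2) / ε ^ 2 *
    pressure γ ε (W ε) (Z ε) y) with hGdef
  have hGeq : ∀ᶠ ε in 𝓝[>] (0 : ℝ), ∀ x,
      G ε x = (1 - ε ^ 2) / ε ^ 2 * dx a b (pressure γ ε (W ε) (Z ε)) x := by
    filter_upwards [eventually_splitting] with ε hs x
    simp only [hGdef, hs, one_mul, dx_const_mul]
  have hpsmooth : ∀ᶠ ε in 𝓝[>] (0 : ℝ),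
      ContDiffOn ℝ ∞ (pressure γ ε (W ε) (Z ε)) (Icc a b) := by
    filter_upwards [hkin.smooth, hZ] with ε h1 h2
    exact contDiffOn_const.mul (h2.2.2.sub h1)
  have hGsmooth : ∀ᶠ ε in 𝓝[>] (0 : ℝ), ContDiffOn ℝ ∞ (G ε) (Icc a b) := by
    filter_upwards [hpsmooth] with ε h1
    exact contDiffOn_dx hab (contDiffOn_const.mul h1)
  have hZq : ∀ᶠ ε in 𝓝[>] (0 : ℝ), ∀ x ∈ Icc a b, (Z ε).q x = Q ε x - k * G ε x := by
    filter_upwards [hstage] with ε h1 x hx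
    have h2 : (Z ε).q x = _ := congrArg (fun z => z.2.1) (h1 x hx)
    rw [h2]
    simp only [eulerRHS, hQdef, hGdef, Prod.snd_add, Prod.fst_add, Prod.smul_snd, Prod.smul_fst,
      smul_eq_mul]
    ring
  set w : ℝ → ℝ → ℝ := fun ε x => H ε x * G ε x with hwdef
  have hwsmooth : ∀ᶠ ε in 𝓝[>] (0 : ℝ), ContDiffOn ℝ ∞ (w ε) (Icc a b) := by
    filter_upwards [hH.smooth, hGsmooth] with ε h1 h2 using h1.mul h2
  have henth : ∀ᶠ ε in 𝓝[>] (0 : ℝ), EqOn (fun y => H ε y * (Z ε).q y)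
      (fun y => H ε y * Q ε y + -k * w ε y) (Icc a b) := by
    filter_upwards [hZq] with ε h1 x hx
    simp only [h1 x hx, hwdef]
    ring
  have henthdx : ∀ᶠ ε in 𝓝[>] (0 : ℝ), ∀ x ∈ Icc a b, dx a b (fun y => H ε y * (Z ε).q y) x =
      dx a b (fun y => H ε y * Q ε y) x - k * dx a b (w ε) x := by
    filter_upwards [henth, hHQ.smooth, hwsmooth] with ε h1 h2 h3 x hx
    rw [dx_congr h1 hx, dx_add hab h2 (contDiffOn_const.mul h3) hx, dx_const_mul]
    ring
  -- the pressure of `Z` without the contribution of `w`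
  set M : ℝ → ℝ → ℝ := fun ε x => (V ε x).2.2 - k * dx a b (fun y => H ε y * Q ε y) x
    - ε ^ 2 * ((W ε).q x ^ 2 / (2 * (W ε).ρ x)) with hMdef
  have hM : SmoothTendsto (𝓝[>] 0) a b M (fun _ => e) := by
    refine ((hV.E.sub hab ((hHQ.dx hab).const_mul hab k)).sub hab hkin).congr
      (Eventually.of_forall fun _ _ _ => rfl) fun x hx => ?_
    simp [dx_const]
  have hp : ∀ᶠ ε in 𝓝[>] (0 : ℝ), EqOn (pressure γ ε (W ε) (Z ε))
      (fun x => (γ - 1) * (M ε x + k ^ 2 * dx a b (w ε) x)) (Icc a b) := by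
    filter_upwards [hstage, henthdx] with ε h1 h2 x hx
    have h3 : (Z ε).E x = (V ε x).2.2 + k * -dx a b (fun y => H ε y * (Z ε).q y) x :=
      congrArg (fun z => z.2.2) (h1 x hx)
    simp only [pressure, h3, h2 x hx, hMdef]
    ring
  have hpdx : ∀ᶠ ε in 𝓝[>] (0 : ℝ), ∀ x ∈ Icc a b, dx a b (pressure γ ε (W ε) (Z ε)) x =
      (γ - 1) * (dx a b (M ε) x + k ^ 2 * dx a b (dx a b (w ε)) x) := by
    filter_upwards [hp, hM.smooth, hwsmooth] with ε h1 h2 h3 x hx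
    rw [dx_congr h1 hx, dx_const_mul]
    simp only [dx_add hab h2 (contDiffOn_const.mul (contDiffOn_dx hab h3)) hx, dx_const_mul]
  have hγ' : γ - 1 ≠ 0 := by linarith
  have hcoef : Tendsto (fun ε : ℝ => ε ^ 2 / (1 - ε ^ 2) / ((γ - 1) * k ^ 2)) (𝓝[>] 0) (𝓝 0) := by
    have h1 := (tendsto_sq_nhdsGT_zero.div (tendsto_const_nhds.sub tendsto_sq_nhdsGT_zero
      (a := (1 : ℝ))) (by norm_num)).div_const ((γ - 1) * k ^ 2)
    simpa using h1
  have hw : SmoothTendsto (𝓝[>] 0) a b w (fun _ => 0) := by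
    refine smoothTendsto_zero_of_dirichlet hab hwsmooth ?_ ?_
      (A := fun ε x => ε ^ 2 / (1 - ε ^ 2) / ((γ - 1) * k ^ 2) * (H ε x)⁻¹)
      (F := fun ε x => -(1 / k ^ 2) * dx a b (M ε) x) ?_ ?_ ?_
    · filter_upwards [hGeq, hNa] with ε h1 h2
      simp [hwdef, h1, h2]
    · filter_upwards [hGeq, hNb] with ε h1 h2
      simp [hwdef, h1, h2]
    · exact (hHinv.scalar_mul hab hcoef).congr (Eventually.of_forall fun _ _ _ => rfl)
        fun x _ => by simp
    · exact ((hM.dx hab).const_mul hab _).congr (Eventually.of_forall fun _ _ _ => rfl)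
        fun x _ => by simp [dx_const]
    · filter_upwards [hpdx, hGeq, eventually_small, hHpos] with ε h1 h2 h3 h4 x hx
      have h5 := (h4 x hx).ne'
      have h6 : ε ≠ 0 := h3.1.ne'
      have h7 : 1 - ε ^ 2 ≠ 0 := by nlinarith [h3.1, h3.2]
      have h8 : w ε x = H ε x * ((1 - ε ^ 2) / ε ^ 2 *
          ((γ - 1) * (dx a b (M ε) x + k ^ 2 * dx a b (dx a b (w ε)) x))) := by
        rw [← h1 x hx, ← h2 x]
      rw [h8]
      field_simp
      ring
  have hG : SmoothTendsto (𝓝[>] 0) a b G (fun _ => 0) := by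
    refine (hw.mul hab hHinv).congr ?_ fun x _ => by simp
    filter_upwards [hHpos] with ε h1 x hx
    have := (h1 x hx).ne'
    simp only [hwdef]
    field_simp
  refine ⟨?_, ?_, ?_⟩
  · refine ((hW.q.dx hab).neg hab).congr (Eventually.of_forall fun _ _ _ => rfl) fun x _ => ?_
    simp only [dx_const_mul]
  · refine (((hflux.dx hab).neg hab).sub hab hG).congr (Eventually.of_forall fun _ _ _ => rfl)
      fun x _ => ?_
    simp only [dx_momentumFlux]
    ring
  · have h1 : SmoothTendsto (𝓝[>] 0) a b (fun ε y => H ε y * (Z ε).q y)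
        (fun _ => (e + (γ - 1) * e) * c) :=
      (hHQ.add hab (hw.const_mul hab (-k))).congr (henth.mono fun _ h => h.symm) fun x _ => by simp
    refine ((h1.dx hab).neg hab).congr (Eventually.of_forall fun _ _ _ => rfl) fun x _ => ?_
    simp [dx_const]

end Stage

/-! ### The zero Mach number limit of one step -/

section Step

variable {s : ℕ} {a b c e γ h : ℝ}

theorem sum_smul_eq_sum_Iio {M : Type*} [AddCommGroup M] [Module ℝ M] (i : Fin s) (α : Fin s → ℝ)
    (f : Fin s → M) (hα : ∀ j, i ≤ j → α j = 0) :
    ∑ j, α j • f j = ∑ j ∈ Finset.Iio i, α j • f j := by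
  refine (Finset.sum_subset (Finset.subset_univ _) fun j _ hj => ?_).symm
  rw [hα j (by simpa using hj), zero_smul]

theorem sum_smul_eq_sum_Iio_add {M : Type*} [AddCommGroup M] [Module ℝ M] (i : Fin s)
    (α : Fin s → ℝ) (f : Fin s → M) (hα : ∀ j, i < j → α j = 0) :
    ∑ j, α j • f j = ∑ j ∈ Finset.Iio i, α j • f j + α i • f i := by
  rw [← Finset.sum_add_sum_compl (Finset.Iio i)]
  congr 1
  refine Finset.sum_eq_single_of_mem i (by simp) fun j hj hji => ?_
  have : i ≤ j := by simpa using hj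
  rw [hα j (lt_of_le_of_ne this (Ne.symm hji)), zero_smul]

theorem Tableau.aI_diag_ne_zero (tab : Tableau s) (hinv : IsUnit tab.aI.det) (i : Fin s) :
    tab.aI i i ≠ 0 := by
  have h1 : tab.aI.det = ∏ j, tab.aI j j :=
    Matrix.det_of_isLowerTriangular _ fun _ _ hij => tab.aI_diagonallyImplicit _ _ hij
  rw [h1, isUnit_iff_ne_zero] at hinv
  exact Finset.prod_ne_zero_iff.1 hinv i (Finset.mem_univ i)

/-- All right-hand sides `K_i` converge in `C^∞([a, b])` to those of the explicit scheme with
densities `R i` for the transport equation `ρ_t + c ρ_x = 0`. The limits of the stage densities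
must be positive; the two hypotheses on this may be verified with the knowledge that the densities
do converge. -/
theorem stateTendsto_stage_eulerRHS (tab : Tableau s) (hinv : IsUnit tab.aI.det) (hab : a < b)
    (hγ : 1 < γ) (he : 0 < e) (hh : h ≠ 0) {U0 U1 : ℝ → Fields} {R₀ : ℝ → ℝ}
    (hU0 : StateTendsto a b c (fun ε => (U0 ε).val) R₀ e) {UE UI : ℝ → Fin s → Fields}
    (hstep : ∀ᶠ ε in 𝓝[>] (0 : ℝ), IsEulerStep tab a b γ ε h (U0 ε) (UE ε) (UI ε) (U1 ε))
    {R : Fin s → ℝ → ℝ}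
    (hR : ∀ i, ∀ x ∈ Icc a b, R i x = R₀ x + h * ∑ j, tab.aE i j * -(c * dx a b (R j) x))
    (hposE : ∀ i, TendstoUniformlyOn (fun ε => (UE ε i).ρ) (R i) (𝓝[>] 0) (Icc a b) →
      ∀ x ∈ Icc a b, 0 < R i x)
    (hposI : ∀ i, TendstoUniformlyOn (fun ε => (UI ε i).ρ)
        (fun x => R₀ x + h * ∑ j, tab.aI i j * -(c * dx a b (R j) x)) (𝓝[>] 0) (Icc a b) →
      ∀ x ∈ Icc a b, 0 < R₀ x + h * ∑ j, tab.aI i j * -(c * dx a b (R j) x)) (i : Fin s) :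
    StateTendsto a b c (fun ε => eulerRHS a b γ ε (UE ε i) (UI ε i))
      (fun x => -(c * dx a b (R i) x)) 0 := by
  induction i using WellFoundedLT.induction with
  | _ i ih =>
    have hK : ∀ j ∈ Finset.Iio i, StateTendsto a b c
        (fun ε => eulerRHS a b γ ε (UE ε j) (UI ε j)) (fun x => -(c * dx a b (R j) x)) 0 :=
      fun j hj => ih j (Finset.mem_Iio.1 hj)
    have hW : StateTendsto a b c (fun ε => (UE ε i).val) (R i) e := by
      refine (hU0.add_smul_sum hab (Finset.Iio i) h (fun j => tab.aE i j) hK).congr ?_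
        fun x hx => ?_
      · filter_upwards [hstep] with ε hε x hx
        have h1 : (UE ε i).val x = _ := (hε.stages x hx i).1
        rw [h1, sum_smul_eq_sum_Iio i (fun j => tab.aE i j) _ (tab.aE_explicit i)]
      · rw [hR i x hx]
        have h1 := sum_smul_eq_sum_Iio i (fun j => tab.aE i j) (fun j => -(c * dx a b (R j) x))
          (tab.aE_explicit i)
        simp only [smul_eq_mul] at h1
        rw [h1]
    have hV := hU0.add_smul_sum hab (Finset.Iio i) h (fun j => tab.aI i j) hK
    have hstage : ∀ᶠ ε in 𝓝[>] (0 : ℝ), ∀ x ∈ Icc a b, (UI ε i).val x =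
        ((U0 ε).val x + h • ∑ j ∈ Finset.Iio i, tab.aI i j • eulerRHS a b γ ε (UE ε j) (UI ε j) x)
          + (h * tab.aI i i) • eulerRHS a b γ ε (UE ε i) (UI ε i) x := by
      filter_upwards [hstep] with ε hε x hx
      have h1 : (UI ε i).val x = _ := (hε.stages x hx i).2
      rw [h1, sum_smul_eq_sum_Iio_add i (fun j => tab.aI i j) _ (tab.aI_diagonallyImplicit i),
        smul_add, mul_smul, add_assoc]
    have hRI : ∀ x, R₀ x + h * ∑ j, tab.aI i j * -(c * dx a b (R j) x) =
        R₀ x + h * ∑ j ∈ Finset.Iio i, tab.aI i j * -(c * dx a b (R j) x)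
          + h * tab.aI i i * -(c * dx a b (R i) x) := by
      intro x
      have := sum_smul_eq_sum_Iio_add i (fun j => tab.aI i j) (fun j => -(c * dx a b (R j) x))
        (tab.aI_diagonallyImplicit i)
      simp only [smul_eq_mul] at this
      rw [this]
      ring
    have hZρ : SmoothTendsto (𝓝[>] 0) a b (fun ε => (UI ε i).ρ)
        (fun x => R₀ x + h * ∑ j, tab.aI i j * -(c * dx a b (R j) x)) := by
      refine (hV.ρ.add hab (((hW.q.dx hab).neg hab).const_mul hab (h * tab.aI i i))).congr ?_
        fun x _ => ?_
      · filter_upwards [hstage] with ε hε x hx using (congrArg Prod.fst (hε x hx)).symm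
      · simp only [dx_const_mul, hRI x]
    exact stateTendsto_eulerRHS hab hγ he (mul_ne_zero hh (tab.aI_diag_ne_zero hinv i)) hV hW
      (hposE i hW.ρ.uniform) hZρ (hposI i hZρ.uniform) (fun x _ => hRI x)
      (hstep.mono fun _ hε => hε.smooth_I i) hstage
      (hstep.mono fun _ hε => hε.neumann_left i) (hstep.mono fun _ hε => hε.neumann_right i)

/-- Numerical solutions that tend to a state of constant velocity and energy have the
incompressible limit. -/
theorem StateTendsto.incompressibleLimit (hab : a < b) {U1 : ℝ → Fields} {R : ℝ → ℝ}
    (hU : StateTendsto a b c (fun ε => (U1 ε).val) R e) (hR : ∀ x ∈ Icc a b, 0 < R x) :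
    IncompressibleLimit a b γ ((γ - 1) * e) U1 := by
  refine ⟨(smoothTendsto_pressure hab hU hR hU).uniform, ?_⟩
  have h1 : SmoothTendsto (𝓝[>] 0) a b (fun ε => (U1 ε).u) (fun _ => c) := by
    refine (hU.q.div hab hU.ρ hR).congr (Eventually.of_forall fun _ _ _ => rfl) fun x hx => ?_
    have := (hR x hx).ne'
    field_simp
  have h2 := (h1.dx hab).uniform
  rwa [dx_const] at h2

/-- The limit of the numerical solution after one step. By stiff accuracy its density is that of
the last implicit stage and therefore positive. -/
theorem step_limit (tab : Tableau s) (hSA : tab.IsStifflyAccurate) (hinv : IsUnit tab.aI.det)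
    (hab : a < b) (hγ : 1 < γ) (he : 0 < e) (hh : h ≠ 0) {U0 U1 : ℝ → Fields} {R₀ : ℝ → ℝ}
    (hU0 : StateTendsto a b c (fun ε => (U0 ε).val) R₀ e) {UE UI : ℝ → Fin s → Fields}
    (hstep : ∀ᶠ ε in 𝓝[>] (0 : ℝ), IsEulerStep tab a b γ ε h (U0 ε) (UE ε) (UI ε) (U1 ε))
    {R : Fin s → ℝ → ℝ}
    (hR : ∀ i, ∀ x ∈ Icc a b, R i x = R₀ x + h * ∑ j, tab.aE i j * -(c * dx a b (R j) x))
    (hposE : ∀ i, TendstoUniformlyOn (fun ε => (UE ε i).ρ) (R i) (𝓝[>] 0) (Icc a b) →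
      ∀ x ∈ Icc a b, 0 < R i x)
    (hposI : ∀ i, TendstoUniformlyOn (fun ε => (UI ε i).ρ)
        (fun x => R₀ x + h * ∑ j, tab.aI i j * -(c * dx a b (R j) x)) (𝓝[>] 0) (Icc a b) →
      ∀ x ∈ Icc a b, 0 < R₀ x + h * ∑ j, tab.aI i j * -(c * dx a b (R j) x)) :
    StateTendsto a b c (fun ε => (U1 ε).val)
        (fun x => R₀ x + h * ∑ j, tab.b j * -(c * dx a b (R j) x)) e ∧
      IncompressibleLimit a b γ ((γ - 1) * e) U1 := by
  have hK := stateTendsto_stage_eulerRHS tab hinv hab hγ he hh hU0 hstep hR hposE hposI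
  have hU1 : StateTendsto a b c (fun ε => (U1 ε).val)
      (fun x => R₀ x + h * ∑ j, tab.b j * -(c * dx a b (R j) x)) e := by
    refine (hU0.add_smul_sum hab Finset.univ h tab.b fun j _ => hK j).congr ?_ fun _ _ => rfl
    filter_upwards [hstep] with ε hε x hx using (hε.update x hx).symm
  refine ⟨hU1, hU1.incompressibleLimit hab ?_⟩
  obtain ⟨l, -, hb, -⟩ := hSA
  simp only [hb]
  refine hposI l ((hU0.add_smul_sum hab Finset.univ h (fun j => tab.aI l j)
    fun j _ => hK j).ρ.uniform.congr ?_)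
  filter_upwards [hstep] with ε hε x hx
    using (congrArg Prod.fst (hε.stages x hx l).2).symm

end Step

/-! ### Well-prepared data -/

section Data

variable {a b γ pStar : ℝ} {ρ₀ u₀ : ℝ → ℝ} {ρ u p : ℝ → ℝ → ℝ}

/-- The form in which the expansions of well-prepared data control the remainders. -/
theorem smoothTendsto_zero_of_iteratedDerivWithin {f : ℝ → ℝ → ℝ}
    (hf : ∀ᶠ ε in 𝓝[>] (0 : ℝ), ContDiffOn ℝ ∞ (f ε) (Icc a b))
    (h : ∀ k : ℕ, ∀ δ > 0, ∀ᶠ ε in 𝓝[>] (0 : ℝ), ∀ x ∈ Icc a b,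
      |iteratedDerivWithin k (f ε) (Icc a b) x| < δ) :
    SmoothTendsto (𝓝[>] 0) a b f (fun _ => 0) := by
  refine fun n => ⟨hf, contDiffOn_const, fun k hk => ?_⟩
  clear hk
  have h0 : (dx a b)^[k] (fun _ => 0) = fun _ => 0 := by
    induction k with
    | zero => rfl
    | succ k ih => rw [Function.iterate_succ_apply', ih, dx_const]
  rw [h0, tendstoUniformlyOn_zero_iff]
  intro δ hδ
  filter_upwards [h k δ hδ] with ε hε x hx
  have := hε x hx
  rwa [iteratedDerivWithin_eq_iterate] at this

theorem eventually_mul_lt {φ : ℝ → ℝ} (hφ : Tendsto φ (𝓝[>] 0) (𝓝 0)) (C : ℝ) {δ : ℝ} (hδ : 0 < δ) :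
    ∀ᶠ ε in 𝓝[>] (0 : ℝ), C * φ ε < δ := by
  have h1 : Tendsto (fun ε => C * φ ε) (𝓝[>] 0) (𝓝 0) := by simpa using hφ.const_mul C
  exact h1.eventually (gt_mem_nhds hδ)

/-- In one space dimension, a divergence-free velocity is constant. -/
theorem IsWellPrepared.velocity_eq (h : IsWellPrepared a b pStar ρ₀ u₀ ρ u p) {x : ℝ}
    (hx : x ∈ Icc a b) : u₀ x = u₀ a :=
  eq_left_of_dx_eq_zero h.u₀_smooth h.u₀_divergenceFree hx

theorem IsWellPrepared.stateTendsto (hab : a < b)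
    (h : IsWellPrepared a b pStar ρ₀ u₀ ρ u p) :
    StateTendsto a b (u₀ a) (fun ε => (fieldsOf γ ε (ρ ε) (u ε) (p ε)).val) ρ₀
      (pStar / (γ - 1)) := by
  have hid : Tendsto (fun ε : ℝ => ε) (𝓝[>] 0) (𝓝 0) := tendsto_id.mono_left nhdsWithin_le_nhds
  have hρ : SmoothTendsto (𝓝[>] 0) a b ρ ρ₀ := by
    have h1 : SmoothTendsto (𝓝[>] 0) a b (fun ε y => ρ ε y - ρ₀ y) (fun _ => 0) := by
      refine smoothTendsto_zero_of_iteratedDerivWithin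
        (h.ρ_smooth.mono fun ε hε => hε.sub h.ρ₀_smooth) fun k δ hδ => ?_
      obtain ⟨C, hC⟩ := h.ρ_expansion k
      filter_upwards [hC, eventually_mul_lt tendsto_sq_nhdsGT_zero C hδ] with ε h1 h2 x hx
        using (h1 x hx).trans_lt h2
    exact (h1.add hab (SmoothTendsto.of_const h.ρ₀_smooth)).congr
      (Eventually.of_forall fun ε x _ => by simp) fun x _ => by simp
  have hu : SmoothTendsto (𝓝[>] 0) a b u (fun _ => u₀ a) := by
    have h1 : SmoothTendsto (𝓝[>] 0) a b (fun ε y => u ε y - u₀ y) (fun _ => 0) := by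
      refine smoothTendsto_zero_of_iteratedDerivWithin
        (h.u_smooth.mono fun ε hε => hε.sub h.u₀_smooth) fun k δ hδ => ?_
      obtain ⟨C, hC⟩ := h.u_expansion k
      filter_upwards [hC, eventually_mul_lt hid C hδ] with ε h1 h2 x hx
        using (h1 x hx).trans_lt h2
    exact (h1.add hab (SmoothTendsto.of_const h.u₀_smooth)).congr
      (Eventually.of_forall fun ε x _ => by simp) fun x hx => by simp [h.velocity_eq hx]
  have hp : SmoothTendsto (𝓝[>] 0) a b p (fun _ => pStar) := by
    obtain ⟨p₂, hp₂, hexp⟩ := h.p_expansion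
    have h1 : SmoothTendsto (𝓝[>] 0) a b (fun ε y => p ε y - pStar - ε ^ 2 * p₂ y)
        (fun _ => 0) := by
      refine smoothTendsto_zero_of_iteratedDerivWithin (h.p_smooth.mono fun ε hε =>
        (hε.sub contDiffOn_const).sub (contDiffOn_const.mul hp₂)) fun k δ hδ => ?_
      filter_upwards [hexp k 1 one_pos, eventually_mul_lt tendsto_sq_nhdsGT_zero 1 hδ]
        with ε h1 h2 x hx using (h1 x hx).trans_lt h2
    have h2 := (SmoothTendsto.of_const hp₂).scalar_mul hab tendsto_sq_nhdsGT_zero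
    exact ((h1.add hab h2).add hab (SmoothTendsto.of_const contDiffOn_const
      (g := fun _ => pStar))).congr (Eventually.of_forall fun ε x _ => by simp) fun x _ => by simp
  refine ⟨hρ, (hρ.mul hab hu).congr (Eventually.of_forall fun _ _ _ => rfl)
    fun x _ => mul_comm _ _, ?_⟩
  have h2 : Tendsto (fun ε : ℝ => ε ^ 2 / 2) (𝓝[>] 0) (𝓝 0) := by
    simpa using tendsto_sq_nhdsGT_zero.div_const 2
  refine ((hp.const_mul hab (1 / (γ - 1))).add hab ((hρ.mul hab (hu.mul hab hu)).scalar_mul hab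
    h2)).congr (Eventually.of_forall fun ε x _ => ?_) fun x _ => ?_
  · simp only [Fields.val, fieldsOf]; ring
  · ring

end Data

/-! ### The order conditions for the explicit part -/

section Order

variable {s : ℕ}

/-- The vector `Ã^k 1`, where `Ã` is the explicit matrix and `1` the vector of ones. -/
def Tableau.stageCoeff (tab : Tableau s) (k : ℕ) : Fin s → ℝ := (tab.aE ^ k).mulVec 1

/-- The coefficients of the stability polynomial of the explicit part: `1` for `k = 0`, and
`b · Ã^(k-1) 1` for `k ≥ 1`. -/
def Tableau.stabilityCoeff (tab : Tableau s) : ℕ → ℝ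
  | 0 => 1
  | k + 1 => ∑ j, tab.b j * tab.stageCoeff k j

/-- The explicit stages for a linear problem: `D k` is the `k`-th derivative of the initial value,
and `θ` the scaled step size. -/
def Tableau.linearStage (tab : Tableau s) (θ : ℝ) (D : ℕ → ℝ) (i : Fin s) : ℝ :=
  ∑ k ∈ Finset.range s, θ ^ k * tab.stageCoeff k i * D k

theorem Tableau.stageCoeff_zero (tab : Tableau s) (i : Fin s) : tab.stageCoeff 0 i = 1 := by
  simp [Tableau.stageCoeff]

theorem Tableau.stageCoeff_succ (tab : Tableau s) (k : ℕ) (i : Fin s) :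
    tab.stageCoeff (k + 1) i = ∑ j, tab.aE i j * tab.stageCoeff k j := by
  rw [Tableau.stageCoeff, pow_succ', ← Matrix.mulVec_mulVec]
  rfl

/-- Strict lower triangularity makes stage `i` vanish from the power `i + 1` on. -/
theorem Tableau.stageCoeff_eq_zero (tab : Tableau s) {k : ℕ} (i : Fin s) (hk : (i : ℕ) < k) :
    tab.stageCoeff k i = 0 := by
  induction k generalizing i with
  | zero => omega
  | succ k ih =>
    rw [tab.stageCoeff_succ]
    refine Finset.sum_eq_zero fun j _ => ?_
    rcases le_or_gt i j with hij | hij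
    · rw [tab.aE_explicit i j hij, zero_mul]
    · rw [ih j (by have : (j : ℕ) < i := hij
                   omega), mul_zero]

/-- The stage equations of the explicit part. The shift `D (k + 1)` is the application of the
linear operator, and the recursion closes because the power `s` of the explicit matrix vanishes.
-/
theorem Tableau.linearStage_eq (tab : Tableau s) (θ : ℝ) (D : ℕ → ℝ) (i : Fin s) :
    tab.linearStage θ D i =
      D 0 + θ * ∑ j, tab.aE i j * tab.linearStage θ (fun k => D (k + 1)) j := by
  have h1 : tab.linearStage θ D i =
      ∑ k ∈ Finset.range (s + 1), θ ^ k * tab.stageCoeff k i * D k := by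
    rw [Finset.sum_range_succ, tab.stageCoeff_eq_zero i i.2]
    simp [Tableau.linearStage]
  rw [h1, Finset.sum_range_succ', tab.stageCoeff_zero, add_comm]
  simp only [pow_zero, one_mul, Tableau.linearStage, Finset.mul_sum]
  rw [Finset.sum_comm]
  congr 1
  refine Finset.sum_congr rfl fun k _ => ?_
  rw [tab.stageCoeff_succ, Finset.mul_sum, Finset.sum_mul]
  exact Finset.sum_congr rfl fun j _ => by ring

theorem Tableau.linearUpdate_eq (tab : Tableau s) (θ : ℝ) (D : ℕ → ℝ) :
    D 0 + θ * ∑ j, tab.b j * tab.linearStage θ (fun k => D (k + 1)) j =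
      ∑ k ∈ Finset.range (s + 1), θ ^ k * tab.stabilityCoeff k * D k := by
  rw [Finset.sum_range_succ', add_comm]
  simp only [pow_zero, one_mul, Tableau.linearStage, Finset.mul_sum, Tableau.stabilityCoeff]
  rw [Finset.sum_comm]
  congr 1
  refine Finset.sum_congr rfl fun k _ => ?_
  rw [Finset.sum_mul]
  exact Finset.sum_congr rfl fun j _ => by ring

theorem Tableau.stabilityCoeff_eq_zero (tab : Tableau s) {k : ℕ} (hk : s < k) :
    tab.stabilityCoeff k = 0 := by
  cases k with
  | zero => omega
  | succ k =>
    refine Finset.sum_eq_zero fun j _ => ?_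
    rw [tab.stageCoeff_eq_zero j (by omega), mul_zero]

theorem coeff_eq_zero_of_isBigO (P : Polynomial ℝ) (n : ℕ)
    (h : (fun x => P.eval x) =O[𝓝[>] 0] (fun x : ℝ => x ^ n)) {k : ℕ} (hk : k < n) :
    P.coeff k = 0 := by
  induction n generalizing P k with
  | zero => omega
  | succ n ih =>
    have h0 : P.coeff 0 = 0 := by
      have h1 : Tendsto (fun x : ℝ => x ^ (n + 1)) (𝓝[>] 0) (𝓝 0) := by
        have := (continuous_pow (M := ℝ) (n + 1)).tendsto 0
        rw [zero_pow n.succ_ne_zero] at this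
        exact this.mono_left nhdsWithin_le_nhds
      have h2 : Tendsto (fun x => P.eval x) (𝓝[>] 0) (𝓝 (P.eval 0)) :=
        P.continuous.continuousAt.tendsto.mono_left nhdsWithin_le_nhds
      rw [Polynomial.coeff_zero_eq_eval_zero]
      exact tendsto_nhds_unique h2 (h.trans_tendsto h1)
    cases k with
    | zero => exact h0
    | succ k =>
      rw [← Polynomial.coeff_divX]
      refine ih P.divX ?_ (by omega)
      obtain ⟨C, hC⟩ := h.bound
      refine IsBigO.of_bound C ?_
      filter_upwards [hC, self_mem_nhdsWithin] with x hx hx0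
      have hx0 : 0 < x := hx0
      have h3 : P.eval x = P.divX.eval x * x := by
        conv_lhs => rw [← Polynomial.divX_mul_X_add P, h0]
        simp
      rw [h3, pow_succ, norm_mul, norm_mul, ← mul_assoc] at hx
      exact le_of_mul_le_mul_right hx (norm_pos_iff.2 hx0.ne')

/-- The order conditions `b · Ã^(k-1) 1 = 1 / k!`, obtained from the scheme applied to the scalar
equation `U' = U`, treated explicitly. -/
theorem Tableau.HasOrder.stabilityCoeff_eq {tab : Tableau s} {r : ℕ} (hr : tab.HasOrder r) {k : ℕ}
    (hk : k ≤ r) : tab.stabilityCoeff k = 1 / (k.factorial : ℝ) := by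
  have hcont : ∀ i, Continuous fun h => tab.linearStage h (fun _ => 1) i := fun i => by
    unfold Tableau.linearStage; fun_prop
  have hE : ∀ i, Tendsto (fun h => tab.linearStage h (fun _ => 1) i) (𝓝[>] 0) (𝓝 1) := fun i => by
    have h1 := ((hcont i).tendsto 0).mono_left (nhdsWithin_le_nhds (s := Ioi 0))
    have h2 := tab.linearStage_eq 0 (fun _ => 1) i
    simp only [zero_mul, add_zero] at h2
    rwa [h2] at h1
  have hI : ∀ i, Tendsto (fun h : ℝ => 1 + h * ∑ j, tab.aI i j * tab.linearStage h (fun _ => 1) j)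
      (𝓝[>] 0) (𝓝 1) := fun i => by
    have h1 : Continuous fun h : ℝ =>
        1 + h * ∑ j, tab.aI i j * tab.linearStage h (fun _ => 1) j := by
      fun_prop
    simpa using (h1.tendsto 0).mono_left (nhdsWithin_le_nhds (s := Ioi 0))
  have key := hr 1 (fun y _ => y) contDiff_fst 1 (fun t _ => Real.exp t) one_pos
    (fun t _ => hasDerivWithinAt_pi.2 fun _ => (Real.hasDerivAt_exp t).hasDerivWithinAt)
    (fun h i _ => tab.linearStage h (fun _ => 1) i)
    (fun h i _ => 1 + h * ∑ j, tab.aI i j * tab.linearStage h (fun _ => 1) j)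
    (Eventually.of_forall fun h i => by
      constructor
      · funext x
        simpa using tab.linearStage_eq h (fun _ => 1) i
      · funext x
        simp)
    (fun i => tendsto_pi_nhds.2 fun _ => by simpa using hE i)
    (fun i => tendsto_pi_nhds.2 fun _ => by simpa using hI i)
  have h1 : (fun h => ∑ k ∈ Finset.range (s + 1), h ^ k * tab.stabilityCoeff k - Real.exp h)
      =O[𝓝[>] 0] (fun h : ℝ => h ^ (r + 1)) := by
    refine (isBigO_pi.1 key 0).congr_left fun h => ?_
    have := tab.linearUpdate_eq h (fun _ => 1)
    simp only [mul_one] at this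
    simp [Tableau.update, ← this]
  have h2 := h1.add ((Real.exp_sub_sum_range_isBigO_pow (r + 1)).mono
    (nhdsWithin_le_nhds (s := Ioi (0 : ℝ))))
  set P : Polynomial ℝ := ∑ k ∈ Finset.range (s + 1), Polynomial.monomial k (tab.stabilityCoeff k)
    - ∑ k ∈ Finset.range (r + 1), Polynomial.monomial k (1 / (k.factorial : ℝ)) with hP
  have h3 : P.coeff k = 0 := by
    refine coeff_eq_zero_of_isBigO P (r + 1) (h2.congr_left fun x => ?_) (Nat.lt_succ_of_le hk)
    simp only [hP, Polynomial.eval_sub, Polynomial.eval_finsetSum, Polynomial.eval_monomial]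
    simp only [div_eq_inv_mul, mul_one, mul_comm (x ^ _) (tab.stabilityCoeff _)]
    ring
  simp only [hP, Polynomial.coeff_sub, Polynomial.finsetSum_coeff, Polynomial.coeff_monomial,
    Finset.sum_ite_eq', Finset.mem_range, Nat.lt_succ_of_le hk, if_true] at h3
  by_cases hks : k < s + 1
  · rw [if_pos hks] at h3
    linarith
  · rw [if_neg hks] at h3
    rw [tab.stabilityCoeff_eq_zero (by omega)]
    linarith

end Order

/-! ### Solutions of the transport equation -/

section Transport

variable {a b T : ℝ}

/-- The directional derivative of a function on the closed rectangle `[0, T] × [a, b]` in the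
direction `v`. -/
noncomputable def rectDeriv (T a b : ℝ) (v : ℝ × ℝ) (F : ℝ × ℝ → ℝ) (z : ℝ × ℝ) : ℝ :=
  fderivWithin ℝ F (Icc 0 T ×ˢ Icc a b) z v

theorem uniqueDiffOn_rect (hT : 0 < T) (hab : a < b) :
    UniqueDiffOn ℝ (Icc (0 : ℝ) T ×ˢ Icc a b) :=
  (uniqueDiffOn_Icc hT).prod (uniqueDiffOn_Icc hab)

theorem contDiffOn_rectDeriv (hT : 0 < T) (hab : a < b) (v : ℝ × ℝ) {F : ℝ × ℝ → ℝ}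
    (hF : ContDiffOn ℝ ∞ F (Icc 0 T ×ˢ Icc a b)) :
    ContDiffOn ℝ ∞ (rectDeriv T a b v F) (Icc 0 T ×ˢ Icc a b) :=
  (hF.fderivWithin (uniqueDiffOn_rect hT hab) (by simp)).clm_apply contDiffOn_const

theorem rectDeriv_comm (hT : 0 < T) (hab : a < b) (v w : ℝ × ℝ) {F : ℝ × ℝ → ℝ}
    (hF : ContDiffOn ℝ ∞ F (Icc 0 T ×ˢ Icc a b)) {z : ℝ × ℝ} (hz : z ∈ Icc 0 T ×ˢ Icc a b) :
    rectDeriv T a b v (rectDeriv T a b w F) z = rectDeriv T a b w (rectDeriv T a b v F) z := by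
  have hu := uniqueDiffOn_rect hT hab
  have hd : DifferentiableWithinAt ℝ (fderivWithin ℝ F (Icc 0 T ×ˢ Icc a b))
      (Icc 0 T ×ˢ Icc a b) z :=
    (hF.fderivWithin hu (m := ∞) (by simp)).differentiableOn (by simp) z hz
  have h1 : ∀ v w : ℝ × ℝ, rectDeriv T a b v (rectDeriv T a b w F) z =
      fderivWithin ℝ (fderivWithin ℝ F (Icc 0 T ×ˢ Icc a b)) (Icc 0 T ×ˢ Icc a b) z v w := by
    intro v w
    have h2 := (hd.hasFDerivWithinAt.clm_apply (hasFDerivWithinAt_const w z _)).fderivWithin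
      (hu z hz)
    unfold rectDeriv
    rw [h2]
    simp
  rw [h1, h1]
  refine (hF z hz).isSymmSndFDerivWithinAt ?_ hu ?_ hz v w
  · rw [minSmoothness_of_isRCLikeNormedField]
    exact WithTop.coe_le_coe.2 le_top
  rw [interior_prod_eq, closure_prod_eq, interior_Icc, interior_Icc, closure_Ioo hT.ne,
    closure_Ioo hab.ne]
  exact hz

theorem rectDeriv_congr {v : ℝ × ℝ} {F G : ℝ × ℝ → ℝ} (h : EqOn F G (Icc 0 T ×ˢ Icc a b))
    {z : ℝ × ℝ} (hz : z ∈ Icc 0 T ×ˢ Icc a b) : rectDeriv T a b v F z = rectDeriv T a b v G z := by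
  rw [rectDeriv, rectDeriv, fderivWithin_congr h (h hz)]

theorem rectDeriv_const_mul (hT : 0 < T) (hab : a < b) (v : ℝ × ℝ) (c : ℝ) {F : ℝ × ℝ → ℝ}
    (hF : ContDiffOn ℝ ∞ F (Icc 0 T ×ˢ Icc a b)) {z : ℝ × ℝ} (hz : z ∈ Icc 0 T ×ˢ Icc a b) :
    rectDeriv T a b v (fun z => c * F z) z = c * rectDeriv T a b v F z := by
  have h1 := (hF.differentiableOn (by simp) z hz).hasFDerivWithinAt.const_mul c
  rw [rectDeriv, h1.fderivWithin (uniqueDiffOn_rect hT hab z hz)]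
  simp [rectDeriv]

theorem hasDerivWithinAt_time {F : ℝ × ℝ → ℝ} (hF : ContDiffOn ℝ ∞ F (Icc 0 T ×ˢ Icc a b))
    {t x : ℝ} (ht : t ∈ Icc 0 T) (hx : x ∈ Icc a b) :
    HasDerivWithinAt (fun τ => F (τ, x)) (rectDeriv T a b (1, 0) F (t, x)) (Icc 0 T) t :=
  (hF.differentiableOn (by simp) (t, x) ⟨ht, hx⟩).hasFDerivWithinAt.comp_hasDerivWithinAt t
    (f := fun τ => (τ, x)) ((hasDerivWithinAt_id t _).prodMk (hasDerivWithinAt_const t _ x))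
    fun _ hτ => ⟨hτ, hx⟩

theorem hasDerivWithinAt_space {F : ℝ × ℝ → ℝ} (hF : ContDiffOn ℝ ∞ F (Icc 0 T ×ˢ Icc a b))
    {t x : ℝ} (ht : t ∈ Icc 0 T) (hx : x ∈ Icc a b) :
    HasDerivWithinAt (fun y => F (t, y)) (rectDeriv T a b (0, 1) F (t, x)) (Icc a b) x :=
  (hF.differentiableOn (by simp) (t, x) ⟨ht, hx⟩).hasFDerivWithinAt.comp_hasDerivWithinAt x
    (f := fun y => (t, y)) ((hasDerivWithinAt_const x _ t).prodMk (hasDerivWithinAt_id x _))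
    fun _ hy => ⟨ht, hy⟩

theorem contDiffOn_time {F : ℝ × ℝ → ℝ} (hF : ContDiffOn ℝ ∞ F (Icc 0 T ×ˢ Icc a b))
    {x : ℝ} (hx : x ∈ Icc a b) : ContDiffOn ℝ ∞ (fun τ => F (τ, x)) (Icc 0 T) :=
  hF.comp (contDiff_id.prodMk contDiff_const).contDiffOn fun _ hτ => ⟨hτ, hx⟩

theorem contDiffOn_space {F : ℝ × ℝ → ℝ} (hF : ContDiffOn ℝ ∞ F (Icc 0 T ×ˢ Icc a b))
    {t : ℝ} (ht : t ∈ Icc 0 T) : ContDiffOn ℝ ∞ (fun y => F (t, y)) (Icc a b) :=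
  hF.comp (contDiff_const.prodMk contDiff_id).contDiffOn fun _ hy => ⟨ht, hy⟩

/-- Taylor expansion in time of a solution of `F_t + c F_x = 0`, with time derivatives replaced by
space derivatives of the initial data. No boundary condition is needed: the expansion uses the
smoothness up to the boundary only, not the characteristics. -/
theorem transport_taylor (hT : 0 < T) (hab : a < b) {F : ℝ × ℝ → ℝ} (c : ℝ)
    (hF : ContDiffOn ℝ ∞ F (Icc 0 T ×ˢ Icc a b))
    (hc : ∀ z ∈ Icc 0 T ×ˢ Icc a b, rectDeriv T a b (1, 0) F z = -c * rectDeriv T a b (0, 1) F z)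
    (r : ℕ) :
    ∃ C : ℝ, ∀ h ∈ Icc 0 T, ∀ x ∈ Icc a b,
      |F (h, x) - ∑ k ∈ Finset.range (r + 1), (-(h * c)) ^ k * (1 / (k.factorial : ℝ)) *
        (dx a b)^[k] (fun y => F (0, y)) x| ≤ C * h ^ (r + 1) := by
  set G : ℕ → ℝ × ℝ → ℝ := fun k => (rectDeriv T a b (0, 1))^[k] F with hG
  have hGs : ∀ k, G (k + 1) = rectDeriv T a b (0, 1) (G k) := fun k =>
    Function.iterate_succ_apply' _ _ _
  have hGsmooth : ∀ k, ContDiffOn ℝ ∞ (G k) (Icc 0 T ×ˢ Icc a b) := by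
    intro k
    induction k with
    | zero => exact hF
    | succ k ih => rw [hGs]; exact contDiffOn_rectDeriv hT hab _ ih
  have hGt : ∀ k, ∀ z ∈ Icc 0 T ×ˢ Icc a b, rectDeriv T a b (1, 0) (G k) z = -c * G (k + 1) z := by
    intro k
    induction k with
    | zero => exact hc
    | succ k ih =>
      intro z hz
      rw [hGs k, rectDeriv_comm hT hab _ _ (hGsmooth k) hz, rectDeriv_congr ih hz,
        rectDeriv_const_mul hT hab _ _ (hGsmooth _) hz, ← hGs]
  have hspace : ∀ k, ∀ x ∈ Icc a b, (dx a b)^[k] (fun y => F (0, y)) x = G k (0, x) := by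
    intro k
    induction k with
    | zero => exact fun _ _ => rfl
    | succ k ih =>
      intro x hx
      rw [Function.iterate_succ_apply', dx_congr ih hx, hGs]
      exact dx_eq_of_hasDerivWithinAt hab hx
        (hasDerivWithinAt_space (hGsmooth k) (left_mem_Icc.2 hT.le) hx)
  have htime : ∀ x ∈ Icc a b, ∀ k, ∀ t ∈ Icc 0 T,
      (dx 0 T)^[k] (fun τ => F (τ, x)) t = (-c) ^ k * G k (t, x) := by
    intro x hx k
    induction k with
    | zero => intro t _; simp [hG]
    | succ k ih =>
      intro t ht
      rw [Function.iterate_succ_apply', dx_congr ih ht, dx_const_mul]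
      beta_reduce
      rw [dx_eq_of_hasDerivWithinAt hT ht (hasDerivWithinAt_time (hGsmooth k) ht hx),
        hGt k _ ⟨ht, hx⟩]
      ring
  obtain ⟨M, hM⟩ := (isCompact_Icc.prod isCompact_Icc).exists_bound_of_continuousOn
    (hGsmooth (r + 1)).continuousOn
  refine ⟨|c| ^ (r + 1) * M / (r.factorial : ℝ), fun h hh x hx => ?_⟩
  have h1 := taylor_mean_remainder_bound (n := r) (C := |c| ^ (r + 1) * M) hT.le
    ((contDiffOn_time hF hx).of_le (by exact_mod_cast le_top)) hh fun y hy => by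
      have h2 := htime x hx (r + 1) y hy
      have h3 : iteratedDerivWithin (r + 1) (fun τ => F (τ, x)) (Icc 0 T) y =
        (dx 0 T)^[r + 1] (fun τ => F (τ, x)) y := iteratedDerivWithin_eq_iterate
      rw [h3, h2, norm_mul, norm_pow, norm_neg, Real.norm_eq_abs]
      gcongr
      exact hM _ ⟨hy, hx⟩
  rw [taylor_within_apply, Real.norm_eq_abs, sub_zero] at h1
  have h4 : ∑ k ∈ Finset.range (r + 1), ((k.factorial : ℝ)⁻¹ * h ^ k) •
      iteratedDerivWithin k (fun τ => F (τ, x)) (Icc 0 T) 0 =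
      ∑ k ∈ Finset.range (r + 1), (-(h * c)) ^ k * (1 / (k.factorial : ℝ)) *
        (dx a b)^[k] (fun y => F (0, y)) x := by
    refine Finset.sum_congr rfl fun k _ => ?_
    have h3 : iteratedDerivWithin k (fun τ => F (τ, x)) (Icc 0 T) 0 =
      (dx 0 T)^[k] (fun τ => F (τ, x)) 0 := iteratedDerivWithin_eq_iterate
    rw [h3, htime x hx k 0 (left_mem_Icc.2 hT.le), hspace k x hx, smul_eq_mul, ← mul_neg, mul_pow]
    ring
  rw [h4] at h1
  exact h1.trans_eq (by ring)

end Transport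

/-! ### The incompressible Euler system in one space dimension -/

section Incompressible

variable {a b T : ℝ} {ρ u p p₂ : ℝ → ℝ → ℝ}

/-- The velocity is constant in space by incompressibility; the momentum balance at the left end
point, where the gradient of `p₂` vanishes, makes it constant in time. -/
theorem IsIncompressibleSolution.velocity_eq (hT : 0 < T) (hab : a < b)
    (h : IsIncompressibleSolution a b T ρ u p p₂) {t x : ℝ} (ht : t ∈ Icc 0 T) (hx : x ∈ Icc a b) :
    u t x = u 0 a := by
  have ha : a ∈ Icc a b := left_mem_Icc.2 hab.le
  have hux : ∀ t ∈ Icc 0 T, ∀ x ∈ Icc a b, u t x = u t a := fun t ht x hx =>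
    eq_left_of_dx_eq_zero (contDiffOn_space h.u_smooth ht) (h.divergenceFree t ht) hx
  rw [hux t ht x hx]
  refine eq_left_of_dx_eq_zero (contDiffOn_time h.u_smooth ha) (fun τ hτ => ?_) ht
  have hρt := hasDerivWithinAt_time h.ρ_smooth hτ ha
  have hut := hasDerivWithinAt_time h.u_smooth hτ ha
  have hflux : ∀ y ∈ Icc a b, ρ τ y * u τ y * u τ y = u τ a * (ρ τ y * u τ y) := fun y hy => by
    rw [hux τ hτ y hy]; ring
  have h1 := h.mass τ hτ a ha
  have h2 := h.momentum τ hτ a ha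
  have e1 : derivWithin (fun τ => ρ τ a) (Icc 0 T) τ = _ :=
    hρt.derivWithin (uniqueDiffOn_Icc hT τ hτ)
  have e2 : derivWithin (fun τ => ρ τ a * u τ a) (Icc 0 T) τ = _ :=
    (hρt.mul hut).derivWithin (uniqueDiffOn_Icc hT τ hτ)
  rw [e1] at h1
  rw [e2, h.neumann_left τ hτ, dx_congr hflux ha, dx_const_mul] at h2
  have e3 : dx 0 T (fun τ => u τ a) τ = _ := dx_eq_of_hasDerivWithinAt hT hτ hut
  have hpos := h.ρ_pos τ hτ a ha
  rw [e3]
  refine (mul_eq_zero.1 (?_ : ρ τ a * _ = 0)).resolve_left hpos.ne'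
  linear_combination h2 - u τ a * h1

theorem IsIncompressibleSolution.pressure_eq (hT : 0 < T) (hab : a < b)
    (h : IsIncompressibleSolution a b T ρ u p p₂) {t x : ℝ} (ht : t ∈ Icc 0 T) (hx : x ∈ Icc a b) :
    p t x = p 0 a := by
  obtain ⟨c, hc⟩ := h.p_const
  rw [hc t ht x hx, hc 0 (left_mem_Icc.2 hT.le) a (left_mem_Icc.2 hab.le)]

/-- The density is transported with the constant velocity `u 0 a`. -/
theorem IsIncompressibleSolution.transport (hT : 0 < T) (hab : a < b)
    (h : IsIncompressibleSolution a b T ρ u p p₂) :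
    ∀ z ∈ Icc 0 T ×ˢ Icc a b, rectDeriv T a b (1, 0) (fun z => ρ z.1 z.2) z =
      -u 0 a * rectDeriv T a b (0, 1) (fun z => ρ z.1 z.2) z := by
  rintro ⟨t, x⟩ ⟨ht, hx⟩
  have h1 := h.mass t ht x hx
  have e1 : derivWithin (fun τ => ρ τ x) (Icc 0 T) t = _ :=
    (hasDerivWithinAt_time h.ρ_smooth ht hx).derivWithin (uniqueDiffOn_Icc hT t ht)
  have e2 : dx a b (ρ t) x = _ :=
    dx_eq_of_hasDerivWithinAt hab hx (hasDerivWithinAt_space h.ρ_smooth ht hx)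
  have hflux : ∀ y ∈ Icc a b, ρ t y * u t y = u 0 a * ρ t y := fun y hy => by
    rw [h.velocity_eq hT hab ht hy, mul_comm]
  rw [e1, dx_congr hflux hx, dx_const_mul] at h1
  simp only [e2] at h1
  linear_combination h1

end Incompressible

/-! ### The limiting densities and the error of one step -/

section Limit

variable {s : ℕ} {a b c h : ℝ} {ρ₀ : ℝ → ℝ}

/-- The densities of the explicit stages for `ρ_t + c ρ_x = 0` with initial value `ρ₀` and step
size `h`. -/
noncomputable def limitDensity (tab : Tableau s) (a b c h : ℝ) (ρ₀ : ℝ → ℝ) (i : Fin s)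
    (x : ℝ) : ℝ :=
  tab.linearStage (-(h * c)) (fun k => (dx a b)^[k] ρ₀ x) i

theorem dx_limitDensity (hab : a < b) (hρ₀ : ContDiffOn ℝ ∞ ρ₀ (Icc a b)) (tab : Tableau s)
    (i : Fin s) {x : ℝ} (hx : x ∈ Icc a b) :
    dx a b (limitDensity tab a b c h ρ₀ i) x =
      tab.linearStage (-(h * c)) (fun k => (dx a b)^[k + 1] ρ₀ x) i := by
  have h1 : ∀ k ∈ Finset.range s, HasDerivWithinAt
      (fun y => (-(h * c)) ^ k * tab.stageCoeff k i * (dx a b)^[k] ρ₀ y)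
      ((-(h * c)) ^ k * tab.stageCoeff k i * (dx a b)^[k + 1] ρ₀ x) (Icc a b) x := fun k _ => by
    rw [Function.iterate_succ_apply']
    exact (hasDerivWithinAt_dx (contDiffOn_iterate_dx hab hρ₀ k) hx).const_mul _
  exact dx_eq_of_hasDerivWithinAt hab hx (HasDerivWithinAt.fun_sum h1)

theorem mul_sum_dx_limitDensity (hab : a < b) (hρ₀ : ContDiffOn ℝ ∞ ρ₀ (Icc a b))
    (tab : Tableau s) (α : Fin s → ℝ) {x : ℝ} (hx : x ∈ Icc a b) :
    h * ∑ j, α j * -(c * dx a b (limitDensity tab a b c h ρ₀ j) x) =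
      -(h * c) * ∑ j, α j * tab.linearStage (-(h * c)) (fun k => (dx a b)^[k + 1] ρ₀ x) j := by
  simp only [dx_limitDensity hab hρ₀ tab _ hx, Finset.mul_sum]
  exact Finset.sum_congr rfl fun j _ => by ring

theorem limitDensity_eq (hab : a < b) (hρ₀ : ContDiffOn ℝ ∞ ρ₀ (Icc a b)) (tab : Tableau s)
    (i : Fin s) {x : ℝ} (hx : x ∈ Icc a b) :
    limitDensity tab a b c h ρ₀ i x =
      ρ₀ x + h * ∑ j, tab.aE i j * -(c * dx a b (limitDensity tab a b c h ρ₀ j) x) := by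
  rw [mul_sum_dx_limitDensity hab hρ₀ tab (fun j => tab.aE i j) hx]
  exact tab.linearStage_eq _ _ i

theorem limitUpdate_eq (hab : a < b) (hρ₀ : ContDiffOn ℝ ∞ ρ₀ (Icc a b)) (tab : Tableau s)
    {x : ℝ} (hx : x ∈ Icc a b) :
    ρ₀ x + h * ∑ j, tab.b j * -(c * dx a b (limitDensity tab a b c h ρ₀ j) x) =
      ∑ k ∈ Finset.range (s + 1), (-(h * c)) ^ k * tab.stabilityCoeff k * (dx a b)^[k] ρ₀ x := by
  rw [mul_sum_dx_limitDensity hab hρ₀ tab tab.b hx]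
  exact tab.linearUpdate_eq _ fun k => (dx a b)^[k] ρ₀ x

theorem smoothTendsto_limitDensity (hab : a < b) (hρ₀ : ContDiffOn ℝ ∞ ρ₀ (Icc a b))
    (tab : Tableau s) (c : ℝ) (i : Fin s) :
    SmoothTendsto (𝓝[>] 0) a b (fun h => limitDensity tab a b c h ρ₀ i) ρ₀ := by
  have hcont : ∀ k, Tendsto (fun h : ℝ => (-(h * c)) ^ k * tab.stageCoeff k i) (𝓝[>] 0)
      (𝓝 (0 ^ k * tab.stageCoeff k i)) := fun k => by
    have h1 : Continuous fun h : ℝ => (-(h * c)) ^ k * tab.stageCoeff k i := by fun_prop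
    simpa using (h1.tendsto 0).mono_left (nhdsWithin_le_nhds (s := Ioi 0))
  refine (SmoothTendsto.finset_sum hab (Finset.range s) fun k _ => (SmoothTendsto.of_const
    (contDiffOn_iterate_dx hab hρ₀ k)).scalar_mul hab (hcont k)).congr
    (Eventually.of_forall fun _ _ _ => rfl) fun x _ => ?_
  change ∑ k ∈ Finset.range s, 0 ^ k * tab.stageCoeff k i * (dx a b)^[k] ρ₀ x = ρ₀ x
  rw [Finset.sum_eq_single_of_mem 0 (Finset.mem_range.2 i.pos) fun k _ hk => by
    rw [zero_pow hk, zero_mul, zero_mul]]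
  simp [tab.stageCoeff_zero]

theorem eventually_limitDensity_pos (hab : a < b) (hρ₀ : ContDiffOn ℝ ∞ ρ₀ (Icc a b))
    (hpos : ∀ x ∈ Icc a b, 0 < ρ₀ x) (tab : Tableau s) (c : ℝ) :
    ∀ᶠ h in 𝓝[>] (0 : ℝ), ∀ i, ∀ x ∈ Icc a b, 0 < limitDensity tab a b c h ρ₀ i x ∧
      0 < ρ₀ x + h * ∑ j, tab.aI i j * -(c * dx a b (limitDensity tab a b c h ρ₀ j) x) := by
  rw [eventually_all]
  intro i
  have h1 := (smoothTendsto_limitDensity hab hρ₀ tab c i).uniform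
  have h2 : SmoothTendsto (𝓝[>] 0) a b (fun h x =>
      ρ₀ x + h * ∑ j, tab.aI i j * -(c * dx a b (limitDensity tab a b c h ρ₀ j) x)) ρ₀ := by
    refine ((SmoothTendsto.of_const hρ₀).add hab ((SmoothTendsto.finset_sum hab Finset.univ
      fun j _ => ((((smoothTendsto_limitDensity hab hρ₀ tab c j).dx hab).const_mul hab c).neg
        hab).const_mul hab (tab.aI i j)).scalar_mul hab
      (tendsto_id.mono_left nhdsWithin_le_nhds))).congr
      (Eventually.of_forall fun _ _ _ => rfl) fun x _ => by simp
  filter_upwards [eventually_pos_of_tendstoUniformlyOn hρ₀.continuousOn hpos h1,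
    eventually_pos_of_tendstoUniformlyOn hρ₀.continuousOn hpos h2.uniform] with h h3 h4 x hx
    using ⟨h3 x hx, h4 x hx⟩

/-- Under the order conditions, the limiting density after one step agrees with the Taylor
polynomial of degree `r` up to `O(h^(r+1))`. -/
theorem limitUpdate_sub_taylor_le (hab : a < b) (hρ₀ : ContDiffOn ℝ ∞ ρ₀ (Icc a b))
    {tab : Tableau s} {r : ℕ} (hr : tab.HasOrder r) (c : ℝ) :
    ∃ C : ℝ, ∀ h ∈ Icc (0 : ℝ) 1, ∀ x ∈ Icc a b,
      |∑ k ∈ Finset.range (s + 1), (-(h * c)) ^ k * tab.stabilityCoeff k * (dx a b)^[k] ρ₀ x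
        - ∑ k ∈ Finset.range (r + 1), (-(h * c)) ^ k * (1 / (k.factorial : ℝ)) *
          (dx a b)^[k] ρ₀ x| ≤ C * h ^ (r + 1) := by
  have hbound : ∀ k : ℕ, ∃ M : ℝ, ∀ x ∈ Icc a b, ‖(dx a b)^[k] ρ₀ x‖ ≤ M := fun k =>
    isCompact_Icc.exists_bound_of_continuousOn (contDiffOn_iterate_dx hab hρ₀ k).continuousOn
  choose M hM using hbound
  refine ⟨∑ k ∈ Finset.Ico (r + 1) (r + 1 + (s + 1)), |c| ^ k * |tab.stabilityCoeff k| * M k,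
    fun h hh x hx => ?_⟩
  -- the coefficients vanish beyond `s`, so both sums extend to a common range
  have h1 : ∑ k ∈ Finset.range (s + 1), (-(h * c)) ^ k * tab.stabilityCoeff k * (dx a b)^[k] ρ₀ x =
      ∑ k ∈ Finset.range (r + 1 + (s + 1)),
        (-(h * c)) ^ k * tab.stabilityCoeff k * (dx a b)^[k] ρ₀ x := by
    refine Finset.sum_subset (Finset.range_mono (by omega)) fun k _ hk => ?_
    rw [Finset.mem_range] at hk
    rw [tab.stabilityCoeff_eq_zero (by omega), mul_zero, zero_mul]
  have h2 : ∑ k ∈ Finset.range (r + 1), (-(h * c)) ^ k * (1 / (k.factorial : ℝ)) *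
      (dx a b)^[k] ρ₀ x =
      ∑ k ∈ Finset.range (r + 1), (-(h * c)) ^ k * tab.stabilityCoeff k * (dx a b)^[k] ρ₀ x :=
    Finset.sum_congr rfl fun k hk => by
      rw [hr.stabilityCoeff_eq (Nat.lt_succ_iff.1 (Finset.mem_range.1 hk))]
  rw [h1, h2, ← Finset.sum_Ico_eq_sub _ (by omega), Finset.sum_mul]
  refine (Finset.abs_sum_le_sum_abs _ _).trans (Finset.sum_le_sum fun k hk => ?_)
  rw [abs_mul, abs_mul, abs_pow, abs_neg, abs_mul, abs_of_nonneg hh.1, mul_pow]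
  have h3 : h ^ k ≤ h ^ (r + 1) := pow_le_pow_of_le_one hh.1 hh.2 (Finset.mem_Ico.1 hk).1
  have h4 : |(dx a b)^[k] ρ₀ x| ≤ M k := hM k x hx
  calc h ^ k * |c| ^ k * |tab.stabilityCoeff k| * |(dx a b)^[k] ρ₀ x|
      ≤ h ^ (r + 1) * |c| ^ k * |tab.stabilityCoeff k| * M k := by
        have := hh.1
        gcongr
    _ = |c| ^ k * |tab.stabilityCoeff k| * M k * h ^ (r + 1) := by ring

end Limit

end SIIMEX

theorem mainTheorem2
    {s : ℕ} (tab : SIIMEX.Tableau s) (r : ℕ)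
    (h_order : tab.HasOrder r)
    (h_SA : tab.IsStifflyAccurate)
    (h_inv : IsUnit tab.aI.det)
    (a b γ : ℝ) (hab : a < b) (hγ : 1 < γ)
    (pStar : ℝ) (ρ₀ u₀ : ℝ → ℝ) (ρ u p : ℝ → ℝ → ℝ)
    (h_data : SIIMEX.IsWellPrepared a b pStar ρ₀ u₀ ρ u p) :
    -- the limits, for any time step for which the stage densities stay away from vacuum
    (∀ Δt > 0, ∀ (UE UI : ℝ → Fin s → SIIMEX.Fields) (U1 : ℝ → SIIMEX.Fields),
      (∀ᶠ ε in 𝓝[>] (0 : ℝ), SIIMEX.IsEulerStep tab a b γ ε Δt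
        (SIIMEX.fieldsOf γ ε (ρ ε) (u ε) (p ε)) (UE ε) (UI ε) (U1 ε)) →
      (∃ m > 0, ∀ᶠ ε in 𝓝[>] (0 : ℝ), ∀ i, ∀ x ∈ Icc a b,
        m ≤ (UE ε i).ρ x ∧ m ≤ (UI ε i).ρ x) →
      SIIMEX.IncompressibleLimit a b γ pStar U1) ∧
    -- the limits and the one-step error estimate, for all small time steps
    (∀ (T : ℝ) (ρ_inc u_inc p_inc p₂_inc : ℝ → ℝ → ℝ), 0 < T →
      SIIMEX.IsIncompressibleSolution a b T ρ_inc u_inc p_inc p₂_inc →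
      (∀ x ∈ Icc a b, ρ_inc 0 x = ρ₀ x ∧ u_inc 0 x = u₀ x ∧ p_inc 0 x = pStar) →
      ∃ C > 0, ∃ Δt₀ > 0, Δt₀ ≤ T ∧ ∀ Δt ∈ Ioc 0 Δt₀,
        ∀ (UE UI : ℝ → Fin s → SIIMEX.Fields) (U1 : ℝ → SIIMEX.Fields),
        (∀ᶠ ε in 𝓝[>] (0 : ℝ), SIIMEX.IsEulerStep tab a b γ ε Δt
          (SIIMEX.fieldsOf γ ε (ρ ε) (u ε) (p ε)) (UE ε) (UI ε) (U1 ε)) →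
        SIIMEX.IncompressibleLimit a b γ pStar U1 ∧
        ∃ ρ_lim q_lim p_lim : ℝ → ℝ,
          TendstoUniformlyOn (fun ε => (U1 ε).ρ) ρ_lim (𝓝[>] 0) (Icc a b) ∧
          TendstoUniformlyOn (fun ε => (U1 ε).q) q_lim (𝓝[>] 0) (Icc a b) ∧
          TendstoUniformlyOn (fun ε => SIIMEX.pressure γ ε (U1 ε) (U1 ε)) p_lim
            (𝓝[>] 0) (Icc a b) ∧
          ∀ x ∈ Icc a b,
            |ρ_lim x - ρ_inc Δt x| ≤ C * Δt ^ (r + 1) ∧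
            |q_lim x - ρ_inc Δt x * u_inc Δt x| ≤ C * Δt ^ (r + 1) ∧
            |p_lim x - p_inc Δt x| ≤ C * Δt ^ (r + 1)) := by
  have hγ' : γ - 1 ≠ 0 := by linarith
  have he : 0 < pStar / (γ - 1) := div_pos h_data.pStar_pos (by linarith)
  have hp : (γ - 1) * (pStar / (γ - 1)) = pStar := by field_simp
  have hU0 := h_data.stateTendsto (γ := γ) hab
  have hρ₀ := h_data.ρ₀_smooth
  refine ⟨fun Δt hΔt UE UI U1 hstep hvac => ?_, fun T ρ_inc u_inc p_inc p₂_inc hT hinc hinit => ?_⟩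
  · obtain ⟨m, hm, hvac⟩ := hvac
    -- a lower bound for the stage densities passes to the limit
    have h1 := (SIIMEX.step_limit tab h_SA h_inv hab hγ he hΔt.ne' hU0 hstep
      (fun i x hx => SIIMEX.limitDensity_eq hab hρ₀ tab i hx)
      (fun i hi x hx => hm.trans_le (ge_of_tendsto (hi.tendsto_at hx)
        (hvac.mono fun ε hε => (hε i x hx).1)))
      (fun i hi x hx => hm.trans_le (ge_of_tendsto (hi.tendsto_at hx)
        (hvac.mono fun ε hε => (hε i x hx).2)))).2
    rwa [hp] at h1
  · have ha : a ∈ Icc a b := left_mem_Icc.2 hab.le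
    have hu0 : u_inc 0 a = u₀ a := (hinit a ha).2.1
    obtain ⟨C₁, hC₁⟩ := SIIMEX.transport_taylor hT hab (u₀ a) hinc.ρ_smooth
      (hu0 ▸ hinc.transport hT hab) r
    obtain ⟨C₂, hC₂⟩ := SIIMEX.limitUpdate_sub_taylor_le hab hρ₀ h_order (u₀ a)
    obtain ⟨η, hη, hpos⟩ := mem_nhdsGT_iff_exists_Ioc_subset.1
      (SIIMEX.eventually_limitDensity_pos hab hρ₀ h_data.ρ₀_pos tab (u₀ a))
    set C : ℝ := |C₁| + |C₂| + 1 with hC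
    have hC1 : 0 < C := by positivity
    have hη' : 0 < η := hη
    refine ⟨C * (|u₀ a| + 1), by positivity, min η (min T 1), by positivity,
      (min_le_right _ _).trans (min_le_left _ _), fun Δt hΔt UE UI U1 hstep => ?_⟩
    have hΔη : Δt ≤ η := hΔt.2.trans (min_le_left _ _)
    have hΔT : Δt ∈ Icc 0 T :=
      ⟨hΔt.1.le, hΔt.2.trans ((min_le_right _ _).trans (min_le_left _ _))⟩
    have hΔ1 : Δt ∈ Icc (0 : ℝ) 1 :=
      ⟨hΔt.1.le, hΔt.2.trans ((min_le_right _ _).trans (min_le_right _ _))⟩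
    have hpos' := hpos (⟨hΔt.1, hΔη⟩ : Δt ∈ Ioc 0 η)
    obtain ⟨h1, h2⟩ := SIIMEX.step_limit tab h_SA h_inv hab hγ he hΔt.1.ne' hU0 hstep
      (fun i x hx => SIIMEX.limitDensity_eq hab hρ₀ tab i hx)
      (fun i _ x hx => (hpos' i x hx).1) (fun i _ x hx => (hpos' i x hx).2)
    rw [hp] at h2
    refine ⟨h2, _, _, _, h1.ρ.uniform, h1.q.uniform, h2.1, fun x hx => ?_⟩
    have hpow : 0 ≤ Δt ^ (r + 1) := pow_nonneg hΔt.1.le _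
    rw [SIIMEX.limitUpdate_eq hab hρ₀ tab hx, hinc.velocity_eq hT hab hΔT hx, hu0,
      hinc.pressure_eq hT hab hΔT hx, (hinit a ha).2.2, sub_self, abs_zero]
    have h3 := hC₁ Δt hΔT x hx
    have h4 := hC₂ Δt hΔ1 x hx
    have h5 : ∀ k, (SIIMEX.dx a b)^[k] (fun y => ρ_inc 0 y) x = (SIIMEX.dx a b)^[k] ρ₀ x := fun k =>
      SIIMEX.iterate_dx_congr (fun y hy => (hinit y hy).1) k hx
    simp only [h5] at h3
    rw [abs_sub_comm] at h3
    have h6 := (abs_sub_le _ _ _).trans (add_le_add h4 h3)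
    have h7 : C₂ * Δt ^ (r + 1) + C₁ * Δt ^ (r + 1) ≤ C * Δt ^ (r + 1) := by
      rw [← add_mul]
      refine mul_le_mul_of_nonneg_right ?_ hpow
      linarith [le_abs_self C₁, le_abs_self C₂]
    have h8 := h6.trans h7
    refine ⟨h8.trans ?_, ?_, by positivity⟩
    · refine mul_le_mul_of_nonneg_right ?_ hpow
      nlinarith [abs_nonneg (u₀ a)]
    · rw [mul_comm (ρ_inc Δt x), ← mul_sub, abs_mul]
      calc |u₀ a| * _ ≤ |u₀ a| * (C * Δt ^ (r + 1)) :=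
            mul_le_mul_of_nonneg_left h8 (abs_nonneg _)
        _ ≤ (|u₀ a| + 1) * (C * Δt ^ (r + 1)) := by
            gcongr
            linarith
        _ = C * (|u₀ a| + 1) * Δt ^ (r + 1) := by ring
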